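/- Let $K_0>0$, $c_\tau>0$ and $\tfrac12<\sigma\le 1$, and consider the one-dimensional Euler equations \[ \rho_t+(\rho u)_x=0,\qquad (\rho u)_t+(\rho u^2+p)_x=0,\qquad \bigl(\tfrac12\rho u^2+\rho E\bigr)_t+\bigl(u(\tfrac12\rho u^2+\rho E+p)\bigr)_x=0 \] with equation of state \[ E(\tau,S)=\frac{K_0\,e^{S/c_\tau}}{2\sigma-1}\,(\ln(\tau+1))^{1-2\sigma},\qquad p=-\frac{\partial E}{\partial\tau},\qquad \tau=\frac1\rho , \] where $\rho$ is the density, $u$ the velocity and $S$ the specific entropy. At vacuum ($\rho=0$) all conserved densities and all fluxes are understood to be $0$, and $u,S$ carry no meaning. A solution of the Riemann problem with data $U_L=(\rho_L,u_L,S_L)$, $U_R=(\rho_R,u_R,S_R)$ is a self-similar function $U(x,t)=V(x/t)$, $t>0$, $V=(\rho,u,S)$ with $\rho\ge0$, such that $V(\xi)\to U_L$ as $\xi\to-\infty$, $V(\xi)\to U_R$ as $\xi\to+\infty$, and, for some finite set $Z\subset\mathbb R$: (i) every $\xi\notin Z$ either has a neighbourhood on which $\rho=0$, or satisfies $\rho(\xi)>0$,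 $V$ is $C^1$ near $\xi$, and the Euler equations hold at all points $(x,t)$ with $t>0$ and $x/t=\xi$; (ii) at every $s\in Z$ the one-sided limits of $V$ exist (only the limit of $\rho$ is required on a side where $V$ is vacuum near $s$), they satisfy the Rankine–Hugoniot conditions with speed $s$, and the entropy condition holds: if gas crosses the ray $x=st$, the pressure behind it (on the side that the gas enters) is not smaller than the pressure ahead of it. Then for arbitrary data $U_L,U_R$ with $\rho_L,\rho_R>0$ and $u_L,u_R,S_L,S_R\in\mathbb R$ the Riemann problem has a solution, this solution is unique (any two solutions have profiles $V$ that agree except at finitely many values of $\xi=x/t$), and it contains no vacuum: it can be chosen with $\rho\ge\delta$ everywhere for some constant $\delta>0$. -/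

import Mathlib

open Filter Topology

namespace GasRiemann

noncomputable section

/-- A state of the gas: density, velocity, specific entropy. When `ρ = 0` the state is the
vacuum, and `u`, `S` carry no meaning. -/
@[ext]
structure State where
  ρ : ℝ
  u : ℝ
  S : ℝ

/-- The pressure `p = -∂E/∂τ` belonging to an equation of state `E = E(τ, S)`. -/
def pressure (E : ℝ → ℝ → ℝ) (τ S : ℝ) : ℝ :=
  -deriv (fun y => E y S) τ

/-- The pressure at a state (`τ = 1/ρ`), equal to `0` at the vacuum. -/
def State.p (E : ℝ → ℝ → ℝ) (W : State) : ℝ :=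
  if W.ρ = 0 then 0 else pressure E (1 / W.ρ) W.S

/-- The total energy density `ρ u² / 2 + ρ E(1/ρ, S)`; it is `0` at the vacuum. -/
def State.energy (E : ℝ → ℝ → ℝ) (W : State) : ℝ :=
  1 / 2 * W.ρ * W.u ^ 2 + W.ρ * E (1 / W.ρ) W.S

/-- The densities of mass, momentum and energy. -/
def density (E : ℝ → ℝ → ℝ) (W : State) : Fin 3 → ℝ :=
  ![W.ρ, W.ρ * W.u, W.energy E]

/-- The fluxes of mass, momentum and energy. All of them are `0` at the vacuum. -/
def flux (E : ℝ → ℝ → ℝ) (W : State) : Fin 3 → ℝ :=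
  ![W.ρ * W.u, W.ρ * W.u ^ 2 + W.p E, W.u * (W.energy E + W.p E)]

/-- The Euler equations hold at the point `(t, x)` for the field `U = U(t, x)`. -/
def EulerAt (E : ℝ → ℝ → ℝ) (U : ℝ → ℝ → State) (t x : ℝ) : Prop :=
  ∀ i : Fin 3,
    deriv (fun t' => density E (U t' x) i) t + deriv (fun x' => flux E (U t x') i) x = 0

/-- The self-similar field with profile `V`. -/
def selfSimilar (V : ℝ → State) (t x : ℝ) : State := V (x / t)

/-- The profile `V` tends to the state `W` along `l`. If `V` is vacuum along `l`, only the
density is required to converge. -/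
def TendsToState (V : ℝ → State) (l : Filter ℝ) (W : State) : Prop :=
  Tendsto (fun ξ => (V ξ).ρ) l (𝓝 W.ρ) ∧
    ((¬ ∀ᶠ ξ in l, (V ξ).ρ = 0) →
      Tendsto (fun ξ => (V ξ).u) l (𝓝 W.u) ∧ Tendsto (fun ξ => (V ξ).S) l (𝓝 W.S))

/-- The Rankine-Hugoniot conditions for a jump from `L` (left) to `R` (right) of speed `s`. -/
def RankineHugoniot (E : ℝ → ℝ → ℝ) (s : ℝ) (L R : State) : Prop :=
  ∀ i : Fin 3, s * (density E R i - density E L i) = flux E R i - flux E L i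

/-- The entropy condition: the pressure behind a shock is the larger one. If gas crosses the
jump from left to right (backward wave), the state behind is `R`; if gas crosses it from right
to left (forward wave), the state behind is `L`; if no gas crosses it, the jump is a contact
discontinuity and is admissible. (With the Rankine-Hugoniot conditions, equal pressures and
nonzero mass flux force `L = R`, which is why the inequalities need not be strict.) -/
def EntropyCondition (E : ℝ → ℝ → ℝ) (s : ℝ) (L R : State) : Prop :=
  (0 < L.ρ * (L.u - s) → L.p E ≤ R.p E) ∧ (L.ρ * (L.u - s) < 0 → R.p E ≤ L.p E)

/-- `V` is the profile of a solution `U(t, x) = V (x / t)`, `t > 0`, of the Riemann problem for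
the Euler equations with equation of state `E`, left state `UL` and right state `UR`.
The solution may contain vacuum. It is piecewise `C¹`: away from finitely many rays `x = s t`,
each point has a vacuum neighbourhood or is a point of positive density where the solution is
`C¹` and satisfies the equations; across the rays the Rankine-Hugoniot and the entropy conditions
hold. The limits at `-∞` and `+∞` are the initial condition, since for fixed `x` the quotient
`x / t` tends to `-∞` (if `x < 0`) or `+∞` (if `x > 0`) as `t → 0+`. -/
structure IsRiemannSolution (E : ℝ → ℝ → ℝ) (UL UR : State) (V : ℝ → State) : Prop where
  nonneg : ∀ ξ, 0 ≤ (V ξ).ρ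
  left_data : TendsToState V atBot UL
  right_data : TendsToState V atTop UR
  piecewise : ∃ Z : Finset ℝ,
    (∀ ξ, ξ ∉ Z →
      (∀ᶠ η in 𝓝 ξ, (V η).ρ = 0) ∨
      (0 < (V ξ).ρ ∧
        ContDiffAt ℝ 1 (fun η => (V η).ρ) ξ ∧
        ContDiffAt ℝ 1 (fun η => (V η).u) ξ ∧
        ContDiffAt ℝ 1 (fun η => (V η).S) ξ ∧
        ∀ t x : ℝ, 0 < t → x / t = ξ → EulerAt E (selfSimilar V) t x)) ∧
    (∀ s ∈ Z, ∃ L R : State,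
      TendsToState V (𝓝[<] s) L ∧ TendsToState V (𝓝[>] s) R ∧
      RankineHugoniot E s L R ∧ EntropyCondition E s L R)

/-- The equation of state `E = K₀ e^{S/c} (ln(τ+1))^{1-2σ} / (2σ-1)`. -/
def logEnergy (K₀ c σ : ℝ) (τ S : ℝ) : ℝ :=
  K₀ * Real.exp (S / c) / (2 * σ - 1) * Real.log (τ + 1) ^ (1 - 2 * σ)

end

end GasRiemann

open Set

namespace GasRiemann

/-! The argument needs only the separated form E = A(S) h(τ) and the sign, monotonicity and limit
conditions collected in `GasLaw`. Write m = ρ(u − ξ) for the mass flux through the ray x = ξt and C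
= √A k for the Lagrangian sound speed. In smooth flow with m > 0 the entropy is constant and the
profile can vary only where m = C (`LeftHalf.derivatives`). A jump with m > 0 is trivial or a shock,
and a shock satisfies the Lax inequalities: C < m ahead, m < C behind (`IsShock.lax`).

Existence. The states that one backward wave connects to U form a curve on which the velocity is a
strictly decreasing function of the pressure and takes every real value. Forward waves are mirror
images of backward ones. Hence the backward curve of UL and the forward curve of UR cross exactly
once (`exists_intersection`, `intersection_unique`), and the two waves, joined along a contact
discontinuity, solve the problem. Arbitrarily large velocities occur because Φ = ∫ k diverges; this
is where σ ≤ 1 enters, through k ≥ 1/((τ+1) ln(τ+1)) for large τ.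

Uniqueness, with vacuum allowed. The mass flux extends over the jumps to a continuous nonincreasing
function M (`exists_massFlux`), positive exactly to the left of some ray a. There the Lax
inequalities and the monotonicity of M leave only a supersonic constant part, a sonic fan and a
subsonic constant part, that is, one backward wave (`LeftHalf.exists_isBackwardWave`). A fan cannot
last up to a: M = C would tend to 0, although τ stays bounded because fan speeds grow without bound
in τ. So the gas to the left of a has positive pressure. Momentum balance at a transfers this
pressure to the other side, which is therefore not vacuum, and reflection yields one forward wave
there (`exists_waves`). Both waves are then fixed by the unique crossing of the wave curves. -/

/-- An equation of state `E = A(S) h(τ)` with separated variables: `p = A(S) g(τ)`, the Lagrangian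
sound speed is `√A(S) k(τ)`, and `Φ` is a primitive of `k`. -/
structure GasLaw where
  A : ℝ → ℝ
  dA : ℝ → ℝ
  h : ℝ → ℝ
  g : ℝ → ℝ
  k : ℝ → ℝ
  dk : ℝ → ℝ
  Φ : ℝ → ℝ
  A_pos : ∀ S, 0 < A S
  dA_pos : ∀ S, 0 < dA S
  A_surj : ∀ y, 0 < y → ∃ S, A S = y
  hasDerivAt_A : ∀ S, HasDerivAt A (dA S) S
  h_pos : ∀ τ, 0 < τ → 0 < h τ
  g_pos : ∀ τ, 0 < τ → 0 < g τ
  k_pos : ∀ τ, 0 < τ → 0 < k τ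
  dk_neg : ∀ τ, 0 < τ → dk τ < 0
  hasDerivAt_h : ∀ τ, 0 < τ → HasDerivAt h (-g τ) τ
  hasDerivAt_g : ∀ τ, 0 < τ → HasDerivAt g (-(k τ) ^ 2) τ
  hasDerivAt_k : ∀ τ, 0 < τ → HasDerivAt k (dk τ) τ
  hasDerivAt_Φ : ∀ τ, 0 < τ → HasDerivAt Φ (k τ) τ
  continuousOn_dk : ContinuousOn dk (Ioi 0)
  tendsto_g : Tendsto g atTop (𝓝 0)
  -- The speed at which τ travels in a fan is unbounded as τ → ∞, so no fan reaches vacuum at a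
  -- finite speed.
  tendsto_fan : Tendsto (fun τ => Φ τ - τ * k τ) atTop atTop
  -- Since C² = p k²/g, this monotonicity gives the Lax inequalities. The last two conditions
  -- control the Hugoniot curve.
  strictAntiOn_ratio : StrictAntiOn (fun τ => k τ ^ 2 / g τ) (Ioi 0)
  strictMonoOn_ratio : StrictMonoOn (fun τ => h τ / g τ) (Ioi 0)
  tendsto_ratio : Tendsto (fun τ => h τ / g τ) (𝓝[>] 0) (𝓝 0)

/-- Specific volume. -/
noncomputable def State.τ (W : State) : ℝ := 1 / W.ρ

theorem State.τ_pos {W : State} (h : 0 < W.ρ) : 0 < W.τ := one_div_pos.2 h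

theorem State.ρ_mul_τ {W : State} (h : 0 < W.ρ) : W.ρ * W.τ = 1 := by
  unfold State.τ; field_simp

theorem State.one_div_τ (W : State) : 1 / W.τ = W.ρ := by
  unfold State.τ; simp

theorem State.ext_τ {V W : State} (h1 : V.τ = W.τ) (h2 : V.u = W.u) (h3 : V.S = W.S) : V = W := by
  refine State.ext ?_ h2 h3
  rw [← V.one_div_τ, h1, W.one_div_τ]

/-! ### Elementary consequences of the gas law -/

namespace GasLaw

variable (G : GasLaw)

/-- The internal energy. -/
noncomputable def E (τ S : ℝ) : ℝ := G.A S * G.h τ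

/-- The pressure at a state of positive density. -/
noncomputable def P (W : State) : ℝ := G.A W.S * G.g W.τ

/-- The Lagrangian sound speed. -/
noncomputable def C (W : State) : ℝ := √(G.A W.S) * G.k W.τ

/-- The ratio `E / p`. -/
noncomputable def φ (τ : ℝ) : ℝ := G.h τ / G.g τ

theorem strictMono_A : StrictMono G.A :=
  strictMono_of_hasDerivAt_pos G.hasDerivAt_A G.dA_pos

theorem sqrtA_pos (S : ℝ) : 0 < √(G.A S) := Real.sqrt_pos.2 (G.A_pos S)

theorem sq_sqrtA (S : ℝ) : √(G.A S) ^ 2 = G.A S := Real.sq_sqrt (G.A_pos S).le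

theorem P_pos {W : State} (h : 0 < W.ρ) : 0 < G.P W :=
  mul_pos (G.A_pos _) (G.g_pos _ (State.τ_pos h))

theorem C_pos {W : State} (h : 0 < W.ρ) : 0 < G.C W :=
  mul_pos (G.sqrtA_pos _) (G.k_pos _ (State.τ_pos h))

theorem continuousOn_h : ContinuousOn G.h (Ioi 0) := fun τ hτ =>
  (G.hasDerivAt_h τ hτ).continuousAt.continuousWithinAt

theorem continuousOn_g : ContinuousOn G.g (Ioi 0) := fun τ hτ =>
  (G.hasDerivAt_g τ hτ).continuousAt.continuousWithinAt

theorem continuousOn_k : ContinuousOn G.k (Ioi 0) := fun τ hτ =>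
  (G.hasDerivAt_k τ hτ).continuousAt.continuousWithinAt

theorem continuousOn_Φ : ContinuousOn G.Φ (Ioi 0) := fun τ hτ =>
  (G.hasDerivAt_Φ τ hτ).continuousAt.continuousWithinAt

theorem continuousOn_φ : ContinuousOn G.φ (Ioi 0) :=
  G.continuousOn_h.div G.continuousOn_g fun τ hτ => (G.g_pos τ hτ).ne'

theorem continuous_A : Continuous G.A :=
  continuous_iff_continuousAt.2 fun S => (G.hasDerivAt_A S).continuousAt

theorem strictAntiOn_k : StrictAntiOn G.k (Ioi 0) := by
  refine strictAntiOn_of_deriv_neg (convex_Ioi 0) G.continuousOn_k fun τ hτ => ?_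
  rw [interior_Ioi] at hτ
  rw [(G.hasDerivAt_k τ hτ).deriv]
  exact G.dk_neg τ hτ

theorem strictAntiOn_g : StrictAntiOn G.g (Ioi 0) := by
  refine strictAntiOn_of_deriv_neg (convex_Ioi 0) G.continuousOn_g fun τ hτ => ?_
  rw [interior_Ioi] at hτ
  rw [(G.hasDerivAt_g τ hτ).deriv]
  have := G.k_pos τ hτ
  nlinarith

theorem strictMonoOn_Φ : StrictMonoOn G.Φ (Ioi 0) := by
  refine strictMonoOn_of_deriv_pos (convex_Ioi 0) G.continuousOn_Φ fun τ hτ => ?_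
  rw [interior_Ioi] at hτ
  rw [(G.hasDerivAt_Φ τ hτ).deriv]
  exact G.k_pos τ hτ

theorem tendsto_Φ : Tendsto G.Φ atTop atTop := by
  refine tendsto_atTop_mono' _ ?_ G.tendsto_fan
  filter_upwards [eventually_gt_atTop 0] with τ hτ
  have := mul_pos hτ (G.k_pos τ hτ)
  linarith

theorem φ_pos {τ : ℝ} (hτ : 0 < τ) : 0 < G.φ τ := div_pos (G.h_pos τ hτ) (G.g_pos τ hτ)

theorem energy_eq {τ : ℝ} (S : ℝ) (hτ : 0 < τ) : G.E τ S = G.A S * G.g τ * G.φ τ := by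
  have := (G.g_pos τ hτ).ne'
  unfold E φ
  field_simp

theorem pressure_eq {τ : ℝ} (S : ℝ) (hτ : 0 < τ) : pressure G.E τ S = G.A S * G.g τ := by
  unfold pressure
  have : HasDerivAt (fun y => G.E y S) (G.A S * -G.g τ) τ := (G.hasDerivAt_h τ hτ).const_mul _
  rw [this.deriv]; ring

theorem p_eq {W : State} (h : 0 < W.ρ) : W.p G.E = G.P W := by
  unfold State.p P
  rw [if_neg h.ne']
  exact G.pressure_eq _ (State.τ_pos h)

theorem hasDerivAt_φ {τ : ℝ} (hτ : 0 < τ) :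
    HasDerivAt G.φ (-1 + G.φ τ * (G.k τ ^ 2 / G.g τ)) τ := by
  have hg := (G.g_pos τ hτ).ne'
  refine ((G.hasDerivAt_h τ hτ).div (G.hasDerivAt_g τ hτ) hg).congr_deriv ?_
  unfold φ
  field_simp
  ring

/-! ### Shocks: Lax inequalities and Rankine–Hugoniot conditions -/

/-- The mass flux, velocities, pressures and energies on the two sides of a shock; `U` is the
state ahead and `W` the state behind, and the gas moves to the right relative to the shock. -/
structure IsShock (U W : State) (m : ℝ) : Prop where
  ahead : 0 < U.ρ
  behind : 0 < W.ρ
  m_pos : 0 < m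
  compressive : G.P U < G.P W
  velocity : W.u - U.u = m * (W.τ - U.τ)
  momentum : G.P W - G.P U = m ^ 2 * (U.τ - W.τ)
  hugoniot : G.P W * G.φ W.τ - G.P U * G.φ U.τ = (G.P U + G.P W) / 2 * (U.τ - W.τ)

variable {G}

theorem IsShock.τ_lt {U W : State} {m : ℝ} (h : G.IsShock U W m) : W.τ < U.τ := by
  have h1 := h.compressive
  have h2 := h.momentum
  have h3 := pow_pos h.m_pos 2
  by_contra hc
  push Not at hc
  nlinarith

variable (G)

theorem sq_C {W : State} : G.C W ^ 2 = G.A W.S * G.k W.τ ^ 2 := by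
  unfold C; rw [mul_pow, G.sq_sqrtA]

theorem sq_C_eq {W : State} (h : 0 < W.ρ) : G.C W ^ 2 = G.P W * (G.k W.τ ^ 2 / G.g W.τ) := by
  have := (G.g_pos _ (State.τ_pos h)).ne'
  rw [sq_C]; unfold P; field_simp

variable {G}

/-- The Lax inequalities: the flow is supersonic ahead of a shock and subsonic behind it. -/
theorem IsShock.lax {U W : State} {m : ℝ} (h : G.IsShock U W m) : G.C U < m ∧ m < G.C W := by
  have hτ := h.τ_lt
  have hW := State.τ_pos h.behind
  have hU := State.τ_pos h.ahead
  have hm := h.m_pos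
  set p : ℝ → ℝ := fun τ => G.P U - m ^ 2 * (τ - U.τ) with hp
  -- `p` is the Rayleigh line through the state ahead, and H is the energy p φ plus a primitive of
  -- p, so that dH = dE + p dτ along the line. The Hugoniot relation says that H agrees at both
  -- ends, which invites Rolle's theorem.
  set H : ℝ → ℝ := fun τ => p τ * G.φ τ + G.P U * τ - m ^ 2 * (τ - U.τ) ^ 2 / 2 with hH
  have hpd : ∀ τ, HasDerivAt p (-m ^ 2) τ := fun τ => by
    have := (((hasDerivAt_id τ).sub_const U.τ).const_mul (m ^ 2)).const_sub (G.P U)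
    simpa using this
  have hHd : ∀ τ, 0 < τ → HasDerivAt H (G.φ τ * (p τ * (G.k τ ^ 2 / G.g τ) - m ^ 2)) τ := by
    intro τ hτ0
    have h1 := (hpd τ).mul (G.hasDerivAt_φ hτ0)
    have h2 := (hasDerivAt_id τ).const_mul (G.P U)
    have h3 := ((((hasDerivAt_id τ).sub_const U.τ).pow 2).const_mul (m ^ 2)).div_const 2
    refine ((h1.add h2).sub h3).congr_deriv ?_
    simp only [hp, id]
    push_cast
    ring
  have hends : H W.τ = H U.τ := by
    have h1 := h.hugoniot
    have h2 := h.momentum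
    simp only [hH, hp]
    have h3 : G.P U - m ^ 2 * (W.τ - U.τ) = G.P W := by linarith
    rw [h3]
    simp only [sub_self, mul_zero, sub_zero]
    nlinarith
  obtain ⟨x, hx, hx0⟩ := exists_hasDerivAt_eq_zero hτ
    (fun y hy => (hHd y (hW.trans_le hy.1)).continuousAt.continuousWithinAt) hends
    (fun y hy => hHd y (hW.trans hy.1))
  have hx1 : 0 < x := hW.trans hx.1
  -- The point x is sonic. Both p and k²/g strictly decrease in τ, so p k²/g, which is C² at the two
  -- ends, is below m² at U and above it at W.
  have hkey : m ^ 2 = p x * (G.k x ^ 2 / G.g x) := by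
    rcases mul_eq_zero.1 hx0 with h0 | h0
    · exact absurd h0 (G.φ_pos hx1).ne'
    · linarith
  have hr : ∀ τ, 0 < τ → 0 < G.k τ ^ 2 / G.g τ := fun τ h0 =>
    div_pos (pow_pos (G.k_pos τ h0) 2) (G.g_pos τ h0)
  have hm2 := pow_pos hm 2
  have hpx1 : p U.τ < p x := by simp only [hp]; nlinarith [hx.2]
  have hpx2 : p x < p W.τ := by simp only [hp]; nlinarith [hx.1]
  have hpU : p U.τ = G.P U := by simp [hp]
  have hpW : p W.τ = G.P W := by have := h.momentum; simp only [hp]; linarith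
  have hPU := G.P_pos h.ahead
  have r1 := G.strictAntiOn_ratio hx1 hU hx.2
  have r2 := G.strictAntiOn_ratio hW hx1 hx.1
  simp only at r1 r2
  constructor
  · refine lt_of_pow_lt_pow_left₀ 2 hm.le ?_
    rw [G.sq_C_eq h.ahead, hkey, ← hpU]
    exact mul_lt_mul hpx1 r1.le (hr _ hU) (by linarith)
  · refine lt_of_pow_lt_pow_left₀ 2 (G.C_pos h.behind).le ?_
    rw [G.sq_C_eq h.behind, hkey, ← hpW]
    exact mul_lt_mul hpx2 r2.le (hr _ hx1) (by linarith)

variable (G)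

theorem energyDensity_eq {W : State} (h : 0 < W.ρ) :
    W.energy G.E = W.ρ * (1 / 2 * W.u ^ 2 + G.P W * G.φ W.τ) := by
  unfold State.energy
  have := G.energy_eq W.S (State.τ_pos h)
  unfold State.τ at this
  rw [this]; unfold P State.τ; ring

/-- The mass law makes m = ρ(u − s) common to both sides; subtracting multiples of it turns the
momentum and energy laws into balances per unit of mass crossing the jump. -/
theorem rankineHugoniot_iff {s : ℝ} {L R : State} (hL : 0 < L.ρ) (hR : 0 < R.ρ) :
    RankineHugoniot G.E s L R ↔
      R.ρ * (R.u - s) = L.ρ * (L.u - s) ∧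
      L.ρ * (L.u - s) * (R.u - L.u) = G.P L - G.P R ∧
      L.ρ * (L.u - s) * (1 / 2 * R.u ^ 2 + G.P R * G.φ R.τ - (1 / 2 * L.u ^ 2 + G.P L * G.φ L.τ))
        = L.u * G.P L - R.u * G.P R := by
  unfold RankineHugoniot
  rw [Fin.forall_fin_succ, Fin.forall_fin_succ, Fin.forall_fin_one]
  simp only [density, flux, G.energyDensity_eq hL, G.energyDensity_eq hR, G.p_eq hL, G.p_eq hR]
  simp only [Matrix.cons_val_zero, Matrix.cons_val_one, Fin.succ_zero_eq_one, Fin.succ_one_eq_two,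
    Matrix.cons_val]
  constructor
  · rintro ⟨h1, h2, h3⟩
    have h0 : R.ρ * (R.u - s) = L.ρ * (L.u - s) := by linarith
    refine ⟨h0, ?_, ?_⟩
    · linear_combination (-R.u) * h0 - h2
    · linear_combination (-(1 / 2 * R.u ^ 2 + G.P R * G.φ R.τ)) * h0 - h3
  · rintro ⟨h1, h2, h3⟩
    refine ⟨by linarith, ?_, ?_⟩
    · linear_combination (-R.u) * h1 - h2
    · linear_combination (-(1 / 2 * R.u ^ 2 + G.P R * G.φ R.τ)) * h1 - h3

variable {G}

theorem eq_add_flux_mul_τ {W : State} (h : 0 < W.ρ) (s : ℝ) :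
    W.u = s + W.ρ * (W.u - s) * W.τ := by
  have := State.ρ_mul_τ h
  linear_combination (s - W.u) * this

theorem eq_of_P_eq {U W : State} (hW : 0 < W.ρ) (hτ : W.τ = U.τ)
    (hu : W.u = U.u) (hP : G.P W = G.P U) : W = U := by
  refine State.ext_τ hτ hu (G.strictMono_A.injective ?_)
  unfold P at hP
  rw [hτ] at hP
  exact mul_right_cancel₀ (hτ ▸ G.g_pos _ (State.τ_pos hW)).ne' hP

/-- A jump crossed by gas from left to right is trivial or a shock. -/
theorem eq_or_isShock {s : ℝ} {L R : State} (hL : 0 < L.ρ) (hR : 0 < R.ρ)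
    (hm : 0 < L.ρ * (L.u - s)) (hRH : RankineHugoniot G.E s L R)
    (hE : EntropyCondition G.E s L R) : R = L ∨ G.IsShock L R (L.ρ * (L.u - s)) := by
  obtain ⟨h1, h2, h3⟩ := (G.rankineHugoniot_iff hL hR).1 hRH
  have hP := hE.1 hm
  rw [G.p_eq hL, G.p_eq hR] at hP
  have uL := eq_add_flux_mul_τ hL s
  have uR := eq_add_flux_mul_τ hR s
  rw [h1] at uR
  set m := L.ρ * (L.u - s) with hmdef
  have hv : R.u - L.u = m * (R.τ - L.τ) := by linear_combination uR - uL
  have hmom : G.P R - G.P L = m ^ 2 * (L.τ - R.τ) := by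
    rw [hv] at h2; linear_combination h2
  rcases hP.eq_or_lt with heq | hlt
  · left
    have h0 : m ^ 2 * (L.τ - R.τ) = 0 := by rw [← hmom, heq, sub_self]
    have hτ : R.τ = L.τ := by
      rcases mul_eq_zero.1 h0 with h | h
      · exact absurd h (pow_pos hm 2).ne'
      · linarith
    refine eq_of_P_eq hR hτ ?_ heq.symm
    rw [hτ] at hv; linarith
  · right
    refine ⟨hL, hR, hm, hlt, hv, hmom, ?_⟩
    -- Removing the kinetic energy and the work of the mean pressure from the energy balance leaves
    -- m times the Hugoniot relation.
    refine mul_left_cancel₀ hm.ne' ?_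
    linear_combination h3 - (R.u + L.u) / 2 * h2 - (G.P L + G.P R) / 2 * hv

/-- The shock speed is the s solving ρ(u − s) = m ahead, namely s = u − mτ. -/
theorem IsShock.rankineHugoniot {U W : State} {m : ℝ} (h : G.IsShock U W m) :
    RankineHugoniot G.E (U.u - m * U.τ) U W ∧ U.ρ * (U.u - (U.u - m * U.τ)) = m := by
  have hU := State.ρ_mul_τ h.ahead
  have hW := State.ρ_mul_τ h.behind
  have e : U.ρ * (U.u - (U.u - m * U.τ)) = m := by linear_combination m * hU
  refine ⟨(G.rankineHugoniot_iff h.ahead h.behind).2 ?_, e⟩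
  have h1 := h.velocity
  have h2 := h.momentum
  have h3 := h.hugoniot
  rw [e]
  refine ⟨by linear_combination W.ρ * h1 + m * hW, ?_, ?_⟩
  · linear_combination m * h1 + h2
  · have h4 : m * (W.u - U.u) = G.P U - G.P W := by linear_combination m * h1 + h2
    linear_combination m * h3 + (W.u + U.u) / 2 * h4 + (G.P U + G.P W) / 2 * h1

end GasLaw

/-! ### The backward wave curve: monotonicity -/

namespace GasLaw

variable (G : GasLaw)

/-- `W` is reached from `U` by a backward rarefaction wave. -/
structure IsRarefaction (U W : State) : Prop where
  ahead : 0 < U.ρ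
  behind : 0 < W.ρ
  entropy : W.S = U.S
  expansive : U.τ ≤ W.τ
  velocity : W.u = U.u + √(G.A U.S) * (G.Φ W.τ - G.Φ U.τ)

/-- `W` is reached from `U` by a backward rarefaction wave or a backward shock. -/
def OnWaveCurve (U W : State) : Prop :=
  G.IsRarefaction U W ∨ ∃ m, G.IsShock U W m

variable {G}

theorem IsRarefaction.P_le {U W : State} (h : G.IsRarefaction U W) : G.P W ≤ G.P U := by
  unfold P
  rw [h.entropy]
  exact mul_le_mul_of_nonneg_left (G.strictAntiOn_g.antitoneOn (State.τ_pos h.ahead)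
    (State.τ_pos h.behind) h.expansive) (G.A_pos _).le

theorem IsRarefaction.u_le {U W : State} (h : G.IsRarefaction U W) : U.u ≤ W.u := by
  rw [h.velocity]
  have := G.strictMonoOn_Φ.monotoneOn (State.τ_pos h.ahead) (State.τ_pos h.behind) h.expansive
  have := mul_nonneg (G.sqrtA_pos U.S).le (sub_nonneg.2 this)
  linarith

theorem IsShock.u_lt {U W : State} {m : ℝ} (h : G.IsShock U W m) : W.u < U.u := by
  have h1 := h.velocity
  have h2 := h.τ_lt
  have h3 := h.m_pos
  nlinarith

theorem IsShock.sq_velocity {U W : State} {m : ℝ} (h : G.IsShock U W m) :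
    (U.u - W.u) ^ 2 = (G.P W - G.P U) * (U.τ - W.τ) := by
  have h1 := h.velocity
  have h2 := h.momentum
  have h3 : U.u - W.u = m * (U.τ - W.τ) := by linear_combination -h1
  rw [h3, h2]; ring

/-- With d = U.τ − τ the Hugoniot relation reads P (φ(τ) − d/2) = P_U (φ(U.τ) + d/2). If τ
increases, the left bracket grows and the right side shrinks, so P cannot grow as well. -/
theorem IsShock.τ_le_of_P_le {U W W' : State} {m m' : ℝ} (h : G.IsShock U W m)
    (h' : G.IsShock U W' m') (hP : G.P W ≤ G.P W') : W'.τ ≤ W.τ := by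
  by_contra hc
  push Not at hc
  have hφ : G.φ W.τ < G.φ W'.τ :=
    G.strictMonoOn_ratio (State.τ_pos h.behind) (State.τ_pos h'.behind) hc
  have e := h.hugoniot
  have e' := h'.hugoniot
  have hU := G.P_pos h.ahead
  have hW := G.P_pos h.behind
  have hφU := G.φ_pos (State.τ_pos h.ahead)
  have hd := h.τ_lt
  have hd' := h'.τ_lt
  have f : G.P W * (G.φ W.τ - (U.τ - W.τ) / 2) = G.P U * (G.φ U.τ + (U.τ - W.τ) / 2) := by
    linear_combination e
  have f' : G.P W' * (G.φ W'.τ - (U.τ - W'.τ) / 2) = G.P U * (G.φ U.τ + (U.τ - W'.τ) / 2) := by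
    linear_combination e'
  have pos : 0 < G.φ W.τ - (U.τ - W.τ) / 2 := by
    refine (mul_pos_iff_of_pos_left hW).1 ?_
    rw [f]
    exact mul_pos hU (by linarith)
  have l1 : G.P W * (G.φ W.τ - (U.τ - W.τ) / 2) < G.P W' * (G.φ W'.τ - (U.τ - W'.τ) / 2) :=
    mul_lt_mul' hP (by linarith) pos.le (hW.trans_le hP)
  have l2 : G.P U * (G.φ U.τ + (U.τ - W'.τ) / 2) < G.P U * (G.φ U.τ + (U.τ - W.τ) / 2) :=
    mul_lt_mul_of_pos_left (by linarith) hU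
  linarith

/-- Along rarefactions higher pressure means smaller τ, hence smaller Φ. For shocks (Δu)² = ΔP ·
(U.τ − τ), where the first factor grows with the pressure and the second does not decrease. Shocks
lie below the velocity of U and rarefactions not below it. -/
theorem OnWaveCurve.u_lt_of_P_lt {U W W' : State} (h : G.OnWaveCurve U W)
    (h' : G.OnWaveCurve U W') (hP : G.P W < G.P W') : W'.u < W.u := by
  rcases h with h | ⟨m, h⟩ <;> rcases h' with h' | ⟨m', h'⟩
  · have hτ : W'.τ < W.τ := by
      unfold P at hP
      rw [h.entropy, h'.entropy] at hP
      exact (G.strictAntiOn_g.lt_iff_gt (State.τ_pos h.behind) (State.τ_pos h'.behind)).1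
        (lt_of_mul_lt_mul_left hP (G.A_pos _).le)
    have := mul_lt_mul_of_pos_left
      (G.strictMonoOn_Φ (State.τ_pos h'.behind) (State.τ_pos h.behind) hτ) (G.sqrtA_pos U.S)
    rw [h.velocity, h'.velocity]
    linarith
  · exact h'.u_lt.trans_le h.u_le
  · exact absurd (hP.trans_le h'.P_le) h.compressive.not_gt
  · have hτ := h.τ_le_of_P_le h' hP.le
    have h1 := h.sq_velocity
    have h2 := h'.sq_velocity
    have h3 := h.compressive
    have h4 := h.τ_lt
    have h5 : (U.u - W.u) ^ 2 < (U.u - W'.u) ^ 2 := by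
      rw [h1, h2]
      exact mul_lt_mul (by linarith) (by linarith) (by linarith) (by linarith)
    have := lt_of_pow_lt_pow_left₀ 2 (by linarith [h'.u_lt]) h5
    linarith

theorem OnWaveCurve.eq_of_P_eq {U W W' : State} (h : G.OnWaveCurve U W)
    (h' : G.OnWaveCurve U W') (hP : G.P W = G.P W') : W = W' := by
  rcases h with h | ⟨m, h⟩ <;> rcases h' with h' | ⟨m', h'⟩
  · have hτ : W.τ = W'.τ := by
      unfold P at hP
      rw [h.entropy, h'.entropy] at hP
      exact G.strictAntiOn_g.injOn (State.τ_pos h.behind) (State.τ_pos h'.behind)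
        (mul_left_cancel₀ (G.A_pos _).ne' hP)
    exact State.ext_τ hτ (by rw [h.velocity, h'.velocity, hτ]) (h.entropy.trans h'.entropy.symm)
  · exact absurd (h'.compressive.trans_le (hP ▸ h.P_le)) (lt_irrefl _)
  · exact absurd (h.compressive.trans_le (hP ▸ h'.P_le)) (lt_irrefl _)
  · have hτ : W.τ = W'.τ :=
      le_antisymm (h'.τ_le_of_P_le h hP.ge) (h.τ_le_of_P_le h' hP.le)
    refine GasLaw.eq_of_P_eq h.behind hτ ?_ hP
    have h1 := h.sq_velocity
    have h2 := h'.sq_velocity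
    rw [hP, hτ, ← h2] at h1
    have := (sq_eq_sq₀ (by linarith [h.u_lt]) (by linarith [h'.u_lt])).1 h1
    linarith

/-! ### The backward wave curve: every pressure and every velocity occurs -/

theorem exists_isRarefaction_of_P {U : State} (hU : 0 < U.ρ) {p : ℝ} (hp : 0 < p)
    (hpU : p ≤ G.P U) : ∃ W, G.IsRarefaction U W ∧ G.P W = p := by
  have hτ := State.τ_pos hU
  have ht : Tendsto (fun τ => G.A U.S * G.g τ) atTop (𝓝 0) := by
    simpa using G.tendsto_g.const_mul (G.A U.S)
  obtain ⟨τ₁, h1, h2⟩ := ((ht.eventually (gt_mem_nhds hp)).and (eventually_ge_atTop U.τ)).exists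
  have hc : ContinuousOn (fun τ => G.A U.S * G.g τ) (Icc U.τ τ₁) :=
    (continuousOn_const.mul G.continuousOn_g).mono fun x hx => hτ.trans_le hx.1
  obtain ⟨τ, hτ1, hτ2⟩ := intermediate_value_Icc' h2 hc ⟨h1.le, hpU⟩
  have e : State.τ ⟨1 / τ, U.u + √(G.A U.S) * (G.Φ τ - G.Φ U.τ), U.S⟩ = τ := by simp [State.τ]
  have hτ0 : 0 < τ := hτ.trans_le hτ1.1
  refine ⟨⟨1 / τ, U.u + √(G.A U.S) * (G.Φ τ - G.Φ U.τ), U.S⟩,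
    ⟨hU, one_div_pos.2 hτ0, rfl, ?_, ?_⟩, ?_⟩
  · rw [e]; exact hτ1.1
  · rw [e]
  · unfold P; rw [e]; exact hτ2

/-- Arbitrarily large velocities are reached because Φ → ∞; with a bounded Φ the curve would stop at
vacuum. -/
theorem exists_isRarefaction_of_u {U : State} (hU : 0 < U.ρ) {v : ℝ} (hv : U.u ≤ v) :
    ∃ W, G.IsRarefaction U W ∧ W.u = v := by
  have hτ := State.τ_pos hU
  have ht : Tendsto (fun τ => U.u + √(G.A U.S) * (G.Φ τ - G.Φ U.τ)) atTop atTop :=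
    tendsto_atTop_add_const_left _ _
      ((tendsto_atTop_add_const_right _ (-G.Φ U.τ) G.tendsto_Φ).const_mul_atTop (G.sqrtA_pos U.S))
  obtain ⟨τ₁, h1, h2⟩ := ((ht.eventually_ge_atTop v).and (eventually_ge_atTop U.τ)).exists
  have hc : ContinuousOn (fun τ => U.u + √(G.A U.S) * (G.Φ τ - G.Φ U.τ)) (Icc U.τ τ₁) :=
    (continuousOn_const.add (continuousOn_const.mul (G.continuousOn_Φ.sub continuousOn_const))).mono
      fun x hx => hτ.trans_le hx.1
  obtain ⟨τ, hτ1, hτ2⟩ := intermediate_value_Icc h2 hc ⟨by simpa using hv, h1⟩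
  have e : State.τ ⟨1 / τ, U.u + √(G.A U.S) * (G.Φ τ - G.Φ U.τ), U.S⟩ = τ := by simp [State.τ]
  have hτ0 : 0 < τ := hτ.trans_le hτ1.1
  refine ⟨⟨1 / τ, U.u + √(G.A U.S) * (G.Φ τ - G.Φ U.τ), U.S⟩,
    ⟨hU, one_div_pos.2 hτ0, rfl, ?_, ?_⟩, hτ2⟩
  · rw [e]; exact hτ1.1
  · rw [e]

/-- The entropy behind is read off from p = A(S) g(τ), which is solvable because A takes every
positive value. -/
theorem exists_isShock {U : State} (hU : 0 < U.ρ) {τ m p : ℝ} (hτ : 0 < τ) (hτU : τ < U.τ)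
    (hm : 0 < m) (hp : p - G.P U = m ^ 2 * (U.τ - τ))
    (hH : p * G.φ τ - G.P U * G.φ U.τ = (G.P U + p) / 2 * (U.τ - τ)) :
    ∃ W, G.IsShock U W m ∧ G.P W = p ∧ W.u = U.u - m * (U.τ - τ) := by
  have hpU : G.P U < p := by
    have := mul_pos (pow_pos hm 2) (sub_pos.2 hτU)
    linarith
  obtain ⟨S, hS⟩ := G.A_surj (p / G.g τ) (div_pos ((G.P_pos hU).trans hpU) (G.g_pos τ hτ))
  have e : State.τ ⟨1 / τ, U.u - m * (U.τ - τ), S⟩ = τ := by simp [State.τ]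
  have eP : G.P ⟨1 / τ, U.u - m * (U.τ - τ), S⟩ = p := by
    unfold P
    rw [e]
    simp only [hS]
    exact div_mul_cancel₀ _ (G.g_pos τ hτ).ne'
  refine ⟨⟨1 / τ, U.u - m * (U.τ - τ), S⟩, ⟨hU, one_div_pos.2 hτ, hm, ?_, ?_, ?_, ?_⟩, eP, rfl⟩
  · rw [eP]; exact hpU
  · rw [e]; simp only; ring
  · rw [eP, e]; exact hp
  · rw [eP, e]; exact hH

theorem exists_zero_of_tendsto_neg {F : ℝ → ℝ} {c b : ℝ} (hF : ContinuousOn F (Ioi 0))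
    (hc : Tendsto F (𝓝[>] 0) (𝓝 c)) (hc0 : c < 0) (hb : 0 < b) (hFb : 0 < F b) :
    ∃ x, 0 < x ∧ x < b ∧ F x = 0 := by
  obtain ⟨a, ha, ha1, ha2⟩ := ((hc.eventually (gt_mem_nhds hc0)).and
    (Ioo_mem_nhdsGT hb)).exists
  obtain ⟨x, hx, hx0⟩ := intermediate_value_Icc ha2.le
    (hF.mono fun x hx => ha1.trans_le hx.1) ⟨ha.le, hFb.le⟩
  refine ⟨x, ha1.trans_le hx.1, lt_of_le_of_ne hx.2 ?_, hx0⟩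
  rintro rfl
  exact hFb.ne' hx0

theorem exists_isShock_of_P {U : State} (hU : 0 < U.ρ) {p : ℝ} (hp : G.P U < p) :
    ∃ W m, G.IsShock U W m ∧ G.P W = p := by
  have hτ := State.τ_pos hU
  have hP := G.P_pos hU
  have hφ := G.φ_pos hτ
  obtain ⟨τ, h0, h1, h2⟩ := exists_zero_of_tendsto_neg
    -- The Hugoniot relation with p prescribed and τ unknown: F = (p − P_U) φ > 0 at U.τ, and F has
    -- a negative limit at 0 because φ → 0 there.
    (F := fun τ => p * (G.φ τ - (U.τ - τ) / 2) - G.P U * (G.φ U.τ + (U.τ - τ) / 2))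
    (c := p * (0 - (U.τ - 0) / 2) - G.P U * (G.φ U.τ + (U.τ - 0) / 2)) (b := U.τ)
    (by
      have := G.continuousOn_φ
      fun_prop)
    (by
      have h1 : Tendsto G.φ (𝓝[>] 0) (𝓝 0) := G.tendsto_ratio
      have h2 : Tendsto (fun τ : ℝ => (U.τ - τ) / 2) (𝓝[>] 0) (𝓝 ((U.τ - 0) / 2)) :=
        ((tendsto_const_nhds.sub tendsto_id).div_const 2).mono_left nhdsWithin_le_nhds
      exact ((h1.sub h2).const_mul p).sub ((h2.const_add _).const_mul _))
    (by nlinarith [mul_pos hP hφ, mul_pos hP hτ, mul_pos (hP.trans hp) hτ]) hτ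
    (by simp only [sub_self, zero_div, sub_zero, add_zero]; nlinarith)
  have hd := sub_pos.2 h1
  have hdp := sub_pos.2 hp
  obtain ⟨W, hW, hWP, -⟩ := exists_isShock (G := G) hU h0 h1
    (Real.sqrt_pos.2 (div_pos hdp hd)) (p := p)
    (by rw [Real.sq_sqrt (div_pos hdp hd).le]; field_simp) (by linear_combination h2)
  exact ⟨W, _, hW, hWP⟩

theorem exists_isShock_of_u {U : State} (hU : 0 < U.ρ) {v : ℝ} (hv : v < U.u) :
    ∃ W m, G.IsShock U W m ∧ W.u = v := by
  have hτ := State.τ_pos hU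
  have hP := G.P_pos hU
  have hφ := G.φ_pos hτ
  have hv' := sub_pos.2 hv
  obtain ⟨τ, h0, h1, h2⟩ := exists_zero_of_tendsto_neg
    -- Prescribing the velocity forces m = (U.u − v)/(U.τ − τ) and p = P_U + (U.u − v)²/(U.τ − τ). F
    -- is the resulting Hugoniot relation multiplied by U.τ − τ.
    (F := fun τ => (U.u - v) ^ 2 * (G.φ τ - (U.τ - τ) / 2) -
      G.P U * (U.τ - τ) * (G.φ U.τ - G.φ τ + (U.τ - τ)))
    (c := (U.u - v) ^ 2 * (0 - (U.τ - 0) / 2) - G.P U * (U.τ - 0) * (G.φ U.τ - 0 + (U.τ - 0)))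
    (b := U.τ)
    (by
      have := G.continuousOn_φ
      fun_prop)
    (by
      have h1 : Tendsto G.φ (𝓝[>] 0) (𝓝 0) := G.tendsto_ratio
      have h2 : Tendsto (fun τ : ℝ => (U.τ - τ)) (𝓝[>] 0) (𝓝 (U.τ - 0)) :=
        (tendsto_const_nhds.sub tendsto_id).mono_left nhdsWithin_le_nhds
      exact ((h1.sub (h2.div_const 2)).const_mul _).sub
        ((h2.const_mul _).mul ((h1.const_sub _).add h2)))
    (by
      have a1 := mul_pos (pow_pos hv' 2) hτ
      have a2 := mul_pos (mul_pos hP hτ) (add_pos hφ hτ)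
      linarith) hτ
    (by simp only [sub_self, zero_div, sub_zero, mul_zero, zero_mul]; positivity)
  have hd := sub_pos.2 h1
  obtain ⟨W, hW, -, hWu⟩ := exists_isShock (G := G) hU h0 h1 (m := (U.u - v) / (U.τ - τ))
    (div_pos hv' hd) (p := G.P U + (U.u - v) ^ 2 / (U.τ - τ))
    (by field_simp; ring) (by field_simp; linear_combination 2 * h2)
  refine ⟨W, _, hW, ?_⟩
  rw [hWu]; field_simp; ring

theorem exists_onWaveCurve_of_P {U : State} (hU : 0 < U.ρ) {p : ℝ} (hp : 0 < p) :
    ∃ W, G.OnWaveCurve U W ∧ G.P W = p := by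
  rcases le_or_gt p (G.P U) with h | h
  · obtain ⟨W, hW, e⟩ := exists_isRarefaction_of_P hU hp h
    exact ⟨W, Or.inl hW, e⟩
  · obtain ⟨W, m, hW, e⟩ := exists_isShock_of_P hU h
    exact ⟨W, Or.inr ⟨m, hW⟩, e⟩

theorem exists_onWaveCurve_of_u {U : State} (hU : 0 < U.ρ) (v : ℝ) :
    ∃ W, G.OnWaveCurve U W ∧ W.u = v := by
  rcases le_or_gt U.u v with h | h
  · obtain ⟨W, hW, e⟩ := exists_isRarefaction_of_u hU h
    exact ⟨W, Or.inl hW, e⟩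
  · obtain ⟨W, m, hW, e⟩ := exists_isShock_of_u hU h
    exact ⟨W, Or.inr ⟨m, hW⟩, e⟩

theorem OnWaveCurve.behind {U W : State} (h : G.OnWaveCurve U W) : 0 < W.ρ := by
  rcases h with h | ⟨m, h⟩
  exacts [IsRarefaction.behind h, IsShock.behind h]

/-! ### Crossing of two wave curves -/

/-- The parameter is the logarithm of the pressure, so the domain is all of ℝ. A monotone surjection
of ℝ is continuous, hence no regularity of the Hugoniot curve is needed. -/
theorem exists_velocity_function {U : State} (hU : 0 < U.ρ) :
    ∃ f : ℝ → ℝ, Antitone f ∧ Continuous f ∧ Function.Surjective f ∧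
      ∀ y, ∃ W, G.OnWaveCurve U W ∧ G.P W = Real.exp y ∧ W.u = f y := by
  choose W hW hP using fun y : ℝ => exists_onWaveCurve_of_P (G := G) hU (Real.exp_pos y)
  have hanti : Antitone fun y => (W y).u := by
    intro x y hxy
    rcases hxy.eq_or_lt with rfl | hlt
    · exact le_rfl
    · refine ((hW x).u_lt_of_P_lt (hW y) ?_).le
      rw [hP, hP]
      exact Real.exp_lt_exp.2 hlt
  have hsurj : Function.Surjective fun y => (W y).u := by
    intro v
    obtain ⟨W', hW', e⟩ := exists_onWaveCurve_of_u (G := G) hU v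
    have hpos := G.P_pos hW'.behind
    refine ⟨Real.log (G.P W'), ?_⟩
    have : W (Real.log (G.P W')) = W' :=
      (hW _).eq_of_P_eq hW' (by rw [hP, Real.exp_log hpos])
    simp only [this, e]
  refine ⟨_, hanti, ?_, hsurj, fun y => ⟨W y, hW y, hP y, rfl⟩⟩
  have h1 : Monotone fun y => -(W y).u := fun x y hxy => neg_le_neg (hanti hxy)
  have h2 : Continuous fun y => -(W y).u := h1.continuous_of_surjective fun v => by
    obtain ⟨y, hy⟩ := hsurj (-v)
    exact ⟨y, by simp only at hy ⊢; rw [hy, neg_neg]⟩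
  exact h2.neg.congr fun y => neg_neg _

/-- The backward wave curve through `U` meets the mirror image of the one through `U'`. -/
theorem exists_intersection {U U' : State} (hU : 0 < U.ρ) (hU' : 0 < U'.ρ) :
    ∃ W W', G.OnWaveCurve U W ∧ G.OnWaveCurve U' W' ∧ G.P W = G.P W' ∧ W.u = -W'.u := by
  obtain ⟨f, hf, fc, fs, hfW⟩ := exists_velocity_function (G := G) hU
  obtain ⟨f', hf', fc', fs', hfW'⟩ := exists_velocity_function (G := G) hU'
  obtain ⟨a, ha⟩ := fs 0
  obtain ⟨b, hb⟩ := fs' 0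
  -- With f a = 0 = f' b, both functions are nonnegative at min a b and nonpositive at max a b.
  obtain ⟨y, -, hy⟩ := intermediate_value_Icc' (min_le_max (a := a) (b := b))
    (fc.add fc').continuousOn (show (0 : ℝ) ∈ _ from
      ⟨by
        have h1 := hf (le_max_left a b)
        have h2 := hf' (le_max_right a b)
        simp only [Pi.add_apply]; linarith,
      by
        have h1 := hf (min_le_left a b)
        have h2 := hf' (min_le_right a b)
        simp only [Pi.add_apply]; linarith⟩)
  obtain ⟨W, hW, h1, h2⟩ := hfW y
  obtain ⟨W', hW', h1', h2'⟩ := hfW' y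
  refine ⟨W, W', hW, hW', h1.trans h1'.symm, ?_⟩
  simp only [Pi.add_apply] at hy
  rw [h2, h2']; linarith

/-- The intersection of two wave curves is unique. -/
theorem intersection_unique {U U' W W' X X' : State} (h1 : G.OnWaveCurve U W)
    (h2 : G.OnWaveCurve U' W') (h3 : G.P W = G.P W') (h4 : W.u = -W'.u)
    (k1 : G.OnWaveCurve U X) (k2 : G.OnWaveCurve U' X') (k3 : G.P X = G.P X')
    (k4 : X.u = -X'.u) : W = X ∧ W' = X' := by
  have key : G.P W = G.P X := by
    rcases lt_trichotomy (G.P W) (G.P X) with h | h | h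
    · have a1 := h1.u_lt_of_P_lt k1 h
      have a2 := h2.u_lt_of_P_lt k2 (by rw [← h3, ← k3]; exact h)
      linarith
    · exact h
    · have a1 := k1.u_lt_of_P_lt h1 h
      have a2 := k2.u_lt_of_P_lt h2 (by rw [← h3, ← k3]; exact h)
      linarith
  exact ⟨h1.eq_of_P_eq k1 key, h2.eq_of_P_eq k2 (by rw [← h3, ← k3]; exact key)⟩

end GasLaw

/-! ### Local conditions on a profile -/

/-- The regularity required of a profile away from its jumps. -/
def SmoothAt (E : ℝ → ℝ → ℝ) (V : ℝ → State) (ξ : ℝ) : Prop :=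
  (∀ᶠ η in 𝓝 ξ, (V η).ρ = 0) ∨
    (0 < (V ξ).ρ ∧
      ContDiffAt ℝ 1 (fun η => (V η).ρ) ξ ∧
      ContDiffAt ℝ 1 (fun η => (V η).u) ξ ∧
      ContDiffAt ℝ 1 (fun η => (V η).S) ξ ∧
      ∀ t x : ℝ, 0 < t → x / t = ξ → EulerAt E (selfSimilar V) t x)

/-- The conditions required of a profile at its jumps. -/
def JumpAt (E : ℝ → ℝ → ℝ) (V : ℝ → State) (s : ℝ) : Prop :=
  ∃ L R : State, TendsToState V (𝓝[<] s) L ∧ TendsToState V (𝓝[>] s) R ∧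
    RankineHugoniot E s L R ∧ EntropyCondition E s L R

theorem TendsToState.congr {V V' : ℝ → State} {l : Filter ℝ} {W : State}
    (h : TendsToState V l W) (hV : ∀ᶠ ξ in l, V' ξ = V ξ) : TendsToState V' l W := by
  have e : ∀ f : State → ℝ, (fun ξ => f (V ξ)) =ᶠ[l] fun ξ => f (V' ξ) := fun f => by
    filter_upwards [hV] with ξ hξ
    rw [hξ]
  refine ⟨h.1.congr' (e State.ρ), fun hn => ?_⟩
  have hn' : ¬ ∀ᶠ ξ in l, (V ξ).ρ = 0 := fun hv => hn <| by
    filter_upwards [hv, hV] with ξ h1 h2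
    rw [h2, h1]
  exact ⟨(h.2 hn').1.congr' (e State.u), (h.2 hn').2.congr' (e State.S)⟩

theorem tendsToState_of_eventually_eq {V : ℝ → State} {l : Filter ℝ} {W : State}
    (hV : ∀ᶠ ξ in l, V ξ = W) : TendsToState V l W :=
  TendsToState.congr (V := fun _ => W)
    ⟨tendsto_const_nhds, fun _ => ⟨tendsto_const_nhds, tendsto_const_nhds⟩⟩ hV

theorem SmoothAt.congr {E : ℝ → ℝ → ℝ} {V V' : ℝ → State} {ξ : ℝ} (h : SmoothAt E V ξ)
    (hV : ∀ᶠ η in 𝓝 ξ, V' η = V η) : SmoothAt E V' ξ := by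
  have e : ∀ f : State → ℝ, (fun ξ => f (V' ξ)) =ᶠ[𝓝 ξ] fun ξ => f (V ξ) := fun f => by
    filter_upwards [hV] with ξ hξ
    rw [hξ]
  rcases h with h | ⟨h0, h1, h2, h3, h4⟩
  · left
    filter_upwards [h, hV] with η a b
    rw [b, a]
  · right
    refine ⟨by rw [hV.self_of_nhds]; exact h0, h1.congr_of_eventuallyEq (e State.ρ),
      h2.congr_of_eventuallyEq (e State.u), h3.congr_of_eventuallyEq (e State.S), ?_⟩
    intro t x ht hx i
    have ct : ContinuousAt (fun t' : ℝ => x / t') t := by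
      have := ht.ne'
      fun_prop (disch := assumption)
    have cx : ContinuousAt (fun x' : ℝ => x' / t) x := by fun_prop
    have e1 : (fun t' => density E (selfSimilar V' t' x) i) =ᶠ[𝓝 t]
        fun t' => density E (selfSimilar V t' x) i := by
      have : ∀ᶠ t' in 𝓝 t, V' (x / t') = V (x / t') := ct.eventually (by simpa [hx] using hV)
      filter_upwards [this] with t' h'
      simp only [selfSimilar, h']
    have e2 : (fun x' => flux E (selfSimilar V' t x') i) =ᶠ[𝓝 x]
        fun x' => flux E (selfSimilar V t x') i := by
      have : ∀ᶠ x' in 𝓝 x, V' (x' / t) = V (x' / t) := cx.eventually (by simpa [hx] using hV)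
      filter_upwards [this] with t' h'
      simp only [selfSimilar, h']
    rw [e1.deriv_eq, e2.deriv_eq]
    exact h4 t x ht hx i

theorem JumpAt.congr {E : ℝ → ℝ → ℝ} {V V' : ℝ → State} {s : ℝ} (h : JumpAt E V s)
    (hV : ∀ᶠ η in 𝓝 s, V' η = V η) : JumpAt E V' s := by
  obtain ⟨L, R, h1, h2, h3⟩ := h
  exact ⟨L, R, h1.congr (hV.filter_mono nhdsWithin_le_nhds),
    h2.congr (hV.filter_mono nhdsWithin_le_nhds), h3⟩

theorem RankineHugoniot.refl (E : ℝ → ℝ → ℝ) (s : ℝ) (W : State) : RankineHugoniot E s W W :=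
  fun i => by simp

theorem EntropyCondition.refl (E : ℝ → ℝ → ℝ) (s : ℝ) (W : State) : EntropyCondition E s W W :=
  ⟨fun _ => le_rfl, fun _ => le_rfl⟩

theorem tendsToState_of_continuousAt {V : ℝ → State} {ξ : ℝ}
    (h1 : ContinuousAt (fun η => (V η).ρ) ξ) (h2 : ContinuousAt (fun η => (V η).u) ξ)
    (h3 : ContinuousAt (fun η => (V η).S) ξ) {l : Filter ℝ} (hl : l ≤ 𝓝 ξ) :
    TendsToState V l (V ξ) :=
  ⟨h1.mono_left hl, fun _ => ⟨h2.mono_left hl, h3.mono_left hl⟩⟩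

theorem SmoothAt.tendsToState {E : ℝ → ℝ → ℝ} {V : ℝ → State} {ξ : ℝ} (h : SmoothAt E V ξ)
    {l : Filter ℝ} (hl : l ≤ 𝓝 ξ) : TendsToState V l (V ξ) := by
  rcases h with h | ⟨h0, h1, h2, h3, h4⟩
  · refine ⟨?_, fun hn => absurd (h.filter_mono hl) hn⟩
    rw [h.self_of_nhds]
    refine tendsto_const_nhds.congr' ?_
    filter_upwards [hl h] with η hη
    exact hη.symm
  · exact tendsToState_of_continuousAt h1.continuousAt h2.continuousAt h3.continuousAt hl

theorem JumpAt.of_tendsToState {E : ℝ → ℝ → ℝ} {V : ℝ → State} {s : ℝ}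
    (h : TendsToState V (𝓝[<] s) (V s)) (h' : TendsToState V (𝓝[>] s) (V s)) : JumpAt E V s :=
  ⟨V s, V s, h, h', RankineHugoniot.refl _ _ _, EntropyCondition.refl _ _ _⟩

/-- Smooth points count as trivial jumps, so the jump conditions become available at every ray. -/
theorem SmoothAt.jumpAt {E : ℝ → ℝ → ℝ} {V : ℝ → State} {ξ : ℝ} (h : SmoothAt E V ξ) :
    JumpAt E V ξ :=
  JumpAt.of_tendsToState (h.tendsToState nhdsWithin_le_nhds) (h.tendsToState nhdsWithin_le_nhds)

/-! ### Reflection -/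

/-- The state seen in a mirror. -/
def State.refl (W : State) : State := ⟨W.ρ, -W.u, W.S⟩

/-- The profile seen in a mirror. -/
def reflProfile (V : ℝ → State) (ξ : ℝ) : State := (V (-ξ)).refl

theorem State.refl_refl (W : State) : W.refl.refl = W := by
  simp [State.refl]

theorem State.p_refl (E : ℝ → ℝ → ℝ) (W : State) : W.refl.p E = W.p E := rfl

theorem State.energy_refl (E : ℝ → ℝ → ℝ) (W : State) : W.refl.energy E = W.energy E := by
  simp [State.energy, State.refl]

/-- The parity of the conserved densities under reflection. -/
def parity : Fin 3 → ℝ := ![1, -1, 1]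

theorem density_refl (E : ℝ → ℝ → ℝ) (W : State) (i : Fin 3) :
    density E W.refl i = parity i * density E W i := by
  fin_cases i
  · simp [density, parity, State.refl]
  · simp [density, parity, State.refl]
  · simp [density, parity, State.energy_refl]

theorem flux_refl (E : ℝ → ℝ → ℝ) (W : State) (i : Fin 3) :
    flux E W.refl i = -(parity i * flux E W i) := by
  fin_cases i
  · simp [flux, parity, State.refl]
  · simp [flux, parity, State.p_refl]
    simp [State.refl]
  · simp [flux, parity, State.p_refl, State.energy_refl]
    simp [State.refl]

theorem TendsToState.reflect {V : ℝ → State} {l l' : Filter ℝ} {W : State}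
    (h : TendsToState V l' W) (hl : map Neg.neg l = l') :
    TendsToState (reflProfile V) l W.refl := by
  subst hl
  refine ⟨tendsto_map'_iff.1 h.1, fun hn => ?_⟩
  obtain ⟨h1, h2⟩ := h.2 fun hv => hn (eventually_map.1 hv)
  exact ⟨(tendsto_map'_iff.1 h1).neg, tendsto_map'_iff.1 h2⟩

theorem SmoothAt.reflect {E : ℝ → ℝ → ℝ} {V : ℝ → State} {ξ : ℝ} (h : SmoothAt E V (-ξ)) :
    SmoothAt E (reflProfile V) ξ := by
  rcases h with h | ⟨h0, h1, h2, h3, h4⟩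
  · left
    exact (continuous_neg.continuousAt (x := ξ)).eventually h
  · right
    have hn : ContDiffAt ℝ 1 (fun η : ℝ => -η) ξ := contDiff_neg.contDiffAt
    refine ⟨h0, h1.comp ξ hn, (h2.comp ξ hn).neg, h3.comp ξ hn, fun t x ht hx i => ?_⟩
    have h5 := h4 t (-x) ht (by rw [neg_div, hx]) i
    have e1 : (fun t' => density E (selfSimilar (reflProfile V) t' x) i) =
        fun t' => parity i * density E (selfSimilar V t' (-x)) i := by
      funext t'
      simp only [selfSimilar, reflProfile, density_refl, neg_div]
    have e2 : (fun x' => flux E (selfSimilar (reflProfile V) t x') i) =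
        fun x' => -(parity i * (fun y => flux E (selfSimilar V t y) i) (-x')) := by
      funext x'
      simp only [selfSimilar, reflProfile, flux_refl, neg_div]
    rw [e1, e2, deriv.fun_neg, deriv_const_mul_field, deriv_const_mul_field,
      deriv_comp_neg (fun y => flux E (selfSimilar V t y) i)]
    linear_combination parity i * h5

theorem JumpAt.reflect {E : ℝ → ℝ → ℝ} {V : ℝ → State} {s : ℝ} (h : JumpAt E V (-s)) :
    JumpAt E (reflProfile V) s := by
  obtain ⟨L, R, h1, h2, h3, h4, h5⟩ := h
  refine ⟨R.refl, L.refl, h2.reflect (by simp),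
    h1.reflect (by simp), fun i => ?_, ?_⟩
  · have := h3 i
    rw [density_refl, density_refl, flux_refl, flux_refl]
    linear_combination (parity i) * this
  -- Reflection exchanges the two sides, and the mass law allows the flux in the entropy condition
  -- to be read on either of them.
  · have h0 := h3 0
    simp only [density, flux, Matrix.cons_val_zero] at h0
    constructor
    · intro h
      simp only [State.refl] at h
      exact h5 (by linarith)
    · intro h
      simp only [State.refl] at h
      exact h4 (by linarith)

theorem IsRiemannSolution.mk_of_smoothAt {E : ℝ → ℝ → ℝ} {UL UR : State} {V : ℝ → State}
    (h0 : ∀ ξ, 0 ≤ (V ξ).ρ) (hL : TendsToState V atBot UL) (hR : TendsToState V atTop UR)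
    (Z : Finset ℝ) (hS : ∀ ξ, ξ ∉ Z → SmoothAt E V ξ) (hJ : ∀ s ∈ Z, JumpAt E V s) :
    IsRiemannSolution E UL UR V :=
  ⟨h0, hL, hR, Z, hS, hJ⟩

theorem IsRiemannSolution.reflect {E : ℝ → ℝ → ℝ} {UL UR : State} {V : ℝ → State}
    (h : IsRiemannSolution E UL UR V) :
    IsRiemannSolution E UR.refl UL.refl (reflProfile V) := by
  obtain ⟨Z, hS, hJ⟩ := h.piecewise
  refine IsRiemannSolution.mk_of_smoothAt (fun ξ => h.nonneg _)
    (h.right_data.reflect map_neg_atBot) (h.left_data.reflect map_neg_atTop)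
    (Z.image Neg.neg) (fun ξ hξ => SmoothAt.reflect (hS _ fun hZ => hξ ?_)) fun s hs => ?_
  · exact Finset.mem_image.2 ⟨-ξ, hZ, neg_neg ξ⟩
  · obtain ⟨z, hz, rfl⟩ := Finset.mem_image.1 hs
    exact JumpAt.reflect (by rw [neg_neg]; exact hJ z hz)

/-- Two solutions that are constant near `x = at` and have a contact discontinuity there can be
joined. -/
theorem IsRiemannSolution.glue {E : ℝ → ℝ → ℝ} {UL UR W W' : State} {V V' : ℝ → State}
    {a b b' : ℝ} (h : IsRiemannSolution E UL W V) (h' : IsRiemannSolution E W' UR V')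
    (hb : b < a) (hb' : a < b') (hV : ∀ ξ, b ≤ ξ → V ξ = W) (hV' : ∀ ξ, ξ ≤ b' → V' ξ = W')
    (hW : RankineHugoniot E a W W') (hE : EntropyCondition E a W W') :
    IsRiemannSolution E UL UR fun ξ => if ξ < a then V ξ else V' ξ := by
  obtain ⟨Z, hS, hJ⟩ := h.piecewise
  obtain ⟨Z', hS', hJ'⟩ := h'.piecewise
  have eL : ∀ ξ < a, ∀ᶠ η in 𝓝 ξ, (if η < a then V η else V' η) = V η := fun ξ hξ => by
    filter_upwards [gt_mem_nhds hξ] with η hη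
    exact if_pos hη
  have eR : ∀ ξ > a, ∀ᶠ η in 𝓝 ξ, (if η < a then V η else V' η) = V' η := fun ξ hξ => by
    filter_upwards [lt_mem_nhds hξ] with η hη
    exact if_neg hη.not_gt
  refine IsRiemannSolution.mk_of_smoothAt ?_ ?_ ?_
    (insert a (Z.filter (· < a) ∪ Z'.filter (a < ·))) ?_ ?_
  · intro ξ
    split_ifs
    exacts [h.nonneg _, h'.nonneg _]
  · refine h.left_data.congr ?_
    filter_upwards [eventually_lt_atBot a] with ξ hξ
    exact if_pos hξ
  · refine h'.right_data.congr ?_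
    filter_upwards [eventually_gt_atTop a] with ξ hξ
    exact if_neg hξ.not_gt
  · intro ξ hξ
    simp only [Finset.mem_insert, Finset.mem_union, Finset.mem_filter, not_or, not_and] at hξ
    rcases lt_or_gt_of_ne hξ.1 with hlt | hgt
    · exact SmoothAt.congr (hS ξ fun hZ => hξ.2.1 hZ hlt) (eL ξ hlt)
    · exact SmoothAt.congr (hS' ξ fun hZ => hξ.2.2 hZ hgt) (eR ξ hgt)
  · intro s hs
    simp only [Finset.mem_insert, Finset.mem_union, Finset.mem_filter] at hs
    rcases hs with rfl | ⟨hs, hlt⟩ | ⟨hs, hgt⟩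
    · refine ⟨W, W', tendsToState_of_eventually_eq ?_, tendsToState_of_eventually_eq ?_, hW, hE⟩
      · filter_upwards [Ioo_mem_nhdsLT hb] with ξ hξ
        rw [if_pos hξ.2, hV _ hξ.1.le]
      · filter_upwards [Ioo_mem_nhdsGT hb'] with ξ hξ
        rw [if_neg hξ.1.not_gt, hV' _ hξ.2.le]
    · exact JumpAt.congr (hJ s hs) (eL s hlt)
    · exact JumpAt.congr (hJ' s hs) (eR s hgt)

/-! ### The Euler equations for self-similar fields -/

theorem hasDerivAt_comp_div_left {f : ℝ → ℝ} {f' t x : ℝ} (ht : 0 < t)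
    (hf : HasDerivAt f f' (x / t)) :
    HasDerivAt (fun t' => f (x / t')) (-(x / t) * f' / t) t := by
  have h1 : HasDerivAt (fun t' : ℝ => x / t') (-x / t ^ 2) t := by
    simpa [div_eq_mul_inv] using (hasDerivAt_inv ht.ne').const_mul x
  refine (hf.comp t h1).congr_deriv ?_
  field_simp

theorem hasDerivAt_comp_div_right {f : ℝ → ℝ} {f' t x : ℝ} (hf : HasDerivAt f f' (x / t)) :
    HasDerivAt (fun x' => f (x' / t)) (f' / t) x := by
  have h1 : HasDerivAt (fun x' : ℝ => x' / t) (1 / t) x := (hasDerivAt_id x).div_const t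
  refine (hf.comp x h1).congr_deriv ?_
  ring

/-- By the chain rule, ∂ₜ of the density plus ∂ₓ of the flux equals (F − ξ D)/t. -/
theorem eulerAt_selfSimilar_iff {E : ℝ → ℝ → ℝ} {V : ℝ → State} {t x : ℝ} (ht : 0 < t)
    {D F : Fin 3 → ℝ} (hD : ∀ i, HasDerivAt (fun η => density E (V η) i) (D i) (x / t))
    (hF : ∀ i, HasDerivAt (fun η => flux E (V η) i) (F i) (x / t)) :
    EulerAt E (selfSimilar V) t x ↔ ∀ i, F i = x / t * D i := by
  refine forall_congr' fun i => ?_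
  simp only [selfSimilar]
  rw [(hasDerivAt_comp_div_left ht (hD i)).deriv, (hasDerivAt_comp_div_right (hF i)).deriv]
  rw [← add_div, div_eq_zero_iff, or_iff_left ht.ne']
  constructor <;> intro h <;> linarith

namespace GasLaw

variable (G : GasLaw)

/-- The Euler equations in terms of the derivatives of specific volume, velocity and entropy. -/
theorem eulerAt_iff {V : ℝ → State} {t x T v z : ℝ} (ht : 0 < t) (hpos : 0 < (V (x / t)).ρ)
    (hτ : HasDerivAt (fun η => (V η).τ) T (x / t)) (hu : HasDerivAt (fun η => (V η).u) v (x / t))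
    (hS : HasDerivAt (fun η => (V η).S) z (x / t)) :
    EulerAt G.E (selfSimilar V) t x ↔
      v = (V (x / t)).ρ * ((V (x / t)).u - x / t) * T ∧
      (V (x / t)).ρ * ((V (x / t)).u - x / t) * v +
        G.dA (V (x / t)).S * z * G.g (V (x / t)).τ - G.C (V (x / t)) ^ 2 * T = 0 ∧
      (V (x / t)).ρ * ((V (x / t)).u - x / t) * z = 0 := by
  rw [G.sq_C]
  set ξ := x / t with hξ
  have hτ0 := State.τ_pos hpos
  have hρ : HasDerivAt (fun η => (V η).ρ) (-T * (V ξ).ρ ^ 2) ξ := by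
    have h1 := hτ.inv hτ0.ne'
    have h2 : (fun η => (V η).ρ) = (fun η => (V η).τ)⁻¹ := by
      funext η
      rw [← State.one_div_τ, one_div]; rfl
    rw [h2]
    refine h1.congr_deriv ?_
    unfold State.τ
    field_simp
  have hA : HasDerivAt (fun η => G.A (V η).S) (G.dA (V ξ).S * z) ξ :=
    (G.hasDerivAt_A _).comp ξ hS
  have hg : HasDerivAt (fun η => G.g (V η).τ) (-(G.k (V ξ).τ) ^ 2 * T) ξ :=
    HasDerivAt.comp (h := fun η => (V η).τ) ξ (G.hasDerivAt_g _ hτ0) hτ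
  have hh : HasDerivAt (fun η => G.h (V η).τ) (-G.g (V ξ).τ * T) ξ :=
    HasDerivAt.comp (h := fun η => (V η).τ) ξ (G.hasDerivAt_h _ hτ0) hτ
  have hp : HasDerivAt (fun η => (V η).p G.E)
      (G.dA (V ξ).S * z * G.g (V ξ).τ + G.A (V ξ).S * (-(G.k (V ξ).τ) ^ 2 * T)) ξ := by
    refine (hA.mul hg).congr_of_eventuallyEq ?_
    filter_upwards [hρ.continuousAt.eventually (lt_mem_nhds hpos)] with η hη
    exact G.p_eq hη
  have he : HasDerivAt (fun η => (V η).energy G.E)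
      (1 / 2 * (-T * (V ξ).ρ ^ 2) * (V ξ).u ^ 2 + (V ξ).ρ * (V ξ).u * v +
        (-T * (V ξ).ρ ^ 2 * (G.A (V ξ).S * G.h (V ξ).τ) +
          (V ξ).ρ * (G.dA (V ξ).S * z * G.h (V ξ).τ + G.A (V ξ).S * (-G.g (V ξ).τ * T)))) ξ := by
    have h1 := ((hρ.const_mul (1 / 2)).mul (hu.pow 2)).add (hρ.mul (hA.mul hh))
    refine h1.congr_deriv ?_
    simp only [Pi.mul_apply, Pi.pow_apply]
    push_cast
    ring
  have hpe : (V ξ).p G.E = G.A (V ξ).S * G.g (V ξ).τ := G.p_eq hpos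
  have hee : (V ξ).energy G.E =
      1 / 2 * (V ξ).ρ * (V ξ).u ^ 2 + (V ξ).ρ * (G.A (V ξ).S * G.h (V ξ).τ) := rfl
  rw [eulerAt_selfSimilar_iff ht
    (D := ![-T * (V ξ).ρ ^ 2, -T * (V ξ).ρ ^ 2 * (V ξ).u + (V ξ).ρ * v,
      1 / 2 * (-T * (V ξ).ρ ^ 2) * (V ξ).u ^ 2 + (V ξ).ρ * (V ξ).u * v +
        (-T * (V ξ).ρ ^ 2 * (G.A (V ξ).S * G.h (V ξ).τ) +
          (V ξ).ρ * (G.dA (V ξ).S * z * G.h (V ξ).τ + G.A (V ξ).S * (-G.g (V ξ).τ * T)))])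
    (F := ![-T * (V ξ).ρ ^ 2 * (V ξ).u + (V ξ).ρ * v,
      -T * (V ξ).ρ ^ 2 * (V ξ).u ^ 2 + (V ξ).ρ * (2 * (V ξ).u * v) +
        (G.dA (V ξ).S * z * G.g (V ξ).τ + G.A (V ξ).S * (-(G.k (V ξ).τ) ^ 2 * T)),
      v * ((V ξ).energy G.E + (V ξ).p G.E) + (V ξ).u *
        (1 / 2 * (-T * (V ξ).ρ ^ 2) * (V ξ).u ^ 2 + (V ξ).ρ * (V ξ).u * v +
        (-T * (V ξ).ρ ^ 2 * (G.A (V ξ).S * G.h (V ξ).τ) +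
          (V ξ).ρ * (G.dA (V ξ).S * z * G.h (V ξ).τ + G.A (V ξ).S * (-G.g (V ξ).τ * T))) +
        (G.dA (V ξ).S * z * G.g (V ξ).τ + G.A (V ξ).S * (-(G.k (V ξ).τ) ^ 2 * T)))])
    (by
      rw [Fin.forall_fin_succ, Fin.forall_fin_succ, Fin.forall_fin_one]
      exact ⟨hρ, hρ.mul hu, he⟩)
    (by
      rw [Fin.forall_fin_succ, Fin.forall_fin_succ, Fin.forall_fin_one]
      refine ⟨hρ.mul hu, ((hρ.mul (hu.pow 2)).add hp).congr_deriv ?_, hu.mul (he.add hp)⟩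
      simp only [Pi.pow_apply, Matrix.cons_val, Fin.succ_zero_eq_one, Matrix.cons_val_one]
      push_cast
      ring)]
  rw [Fin.forall_fin_succ, Fin.forall_fin_succ, Fin.forall_fin_one]
  simp only [Matrix.cons_val_zero, Matrix.cons_val_one, Fin.succ_zero_eq_one, Fin.succ_one_eq_two,
    Matrix.cons_val, ← hξ]
  rw [hpe, hee]
  -- After subtracting multiples of the mass and momentum equations, the energy equation becomes A′h
  -- · ρ(u − ξ) S′ = 0. The nonzero factor A′h = ∂E/∂S cancels, which leaves transport of entropy.
  have hdh : G.dA (V ξ).S * G.h (V ξ).τ ≠ 0 := (mul_pos (G.dA_pos _) (G.h_pos _ hτ0)).ne'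
  generalize G.dA (V ξ).S = a' at *
  generalize G.A (V ξ).S = a at *
  generalize G.h (V ξ).τ = h at *
  generalize G.g (V ξ).τ = g at *
  generalize G.k (V ξ).τ = k at *
  generalize (V ξ).u = u at *
  have hr := hpos.ne'
  generalize (V ξ).ρ = ρ at *
  constructor
  · rintro ⟨h1, h2, h3⟩
    have e1 : v = ρ * (u - ξ) * T := by
      refine mul_left_cancel₀ hr ?_
      linear_combination h1
    have e2 : ρ * (u - ξ) * v + a' * z * g - a * k ^ 2 * T = 0 := by
      linear_combination h2 - u * h1
    refine ⟨e1, e2, ?_⟩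
    have : a' * h * (ρ * (u - ξ) * z) = 0 := by
      linear_combination h3 - (1 / 2 * u ^ 2 + a * h) * h1 - u * e2 - a * g * e1
    rcases mul_eq_zero.1 this with h | h
    exacts [absurd h hdh, h]
  · rintro ⟨e1, e2, e3⟩
    have h1 : -T * ρ ^ 2 * u + ρ * v = ξ * (-T * ρ ^ 2) := by linear_combination ρ * e1
    refine ⟨h1, ?_, ?_⟩
    · linear_combination e2 + u * h1
    · linear_combination (a' * h) * e3 + (1 / 2 * u ^ 2 + a * h) * h1 + u * e2 + a * g * e1

end GasLaw

theorem contDiffAt_one_of_hasDerivAt {f f' : ℝ → ℝ} {x : ℝ}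
    (hf : ∀ᶠ y in 𝓝 x, HasDerivAt f (f' y) y) (hc : ∀ᶠ y in 𝓝 x, ContinuousAt f' y) :
    ContDiffAt ℝ 1 f x := by
  rw [contDiffAt_one_iff]
  refine ⟨fun y => ContinuousLinearMap.toSpanSingleton ℝ (f' y), _, hf.and hc, ?_, ?_⟩
  · intro y hy
    refine ContinuousAt.continuousWithinAt ?_
    exact ((ContinuousLinearMap.toSpanSingletonCLE (𝕜 := ℝ) (E := ℝ)).continuous.continuousAt).comp
      hy.2
  · intro y hy
    exact hy.1.hasFDerivAt

/-! ### Construction of a solution -/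

namespace GasLaw

variable (G : GasLaw)

/-- The speed at which the specific volume `τ` travels in a backward rarefaction wave. -/
noncomputable def fan (U : State) (τ : ℝ) : ℝ :=
  U.u + √(G.A U.S) * (G.Φ τ - G.Φ U.τ - τ * G.k τ)

/-- The states in a backward rarefaction wave. -/
noncomputable def fanState (U : State) (τ : ℝ) : State :=
  ⟨1 / τ, U.u + √(G.A U.S) * (G.Φ τ - G.Φ U.τ), U.S⟩

theorem fanState_τ (U : State) (τ : ℝ) : (G.fanState U τ).τ = τ := by
  simp [fanState, State.τ]

theorem fanState_self (U : State) : G.fanState U U.τ = U := by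
  simp [fanState, State.τ]

variable {G} in
theorem IsRarefaction.eq_fanState {U W : State} (h : G.IsRarefaction U W) :
    W = G.fanState U W.τ :=
  State.ext_τ (by rw [fanState_τ]) h.velocity h.entropy

theorem hasDerivAt_fan (U : State) {τ : ℝ} (hτ : 0 < τ) :
    HasDerivAt (G.fan U) (√(G.A U.S) * -(τ * G.dk τ)) τ := by
  have h1 := ((((G.hasDerivAt_Φ τ hτ).sub_const (G.Φ U.τ)).sub
    ((hasDerivAt_id τ).mul (G.hasDerivAt_k τ hτ))).const_mul (√(G.A U.S))).const_add U.u
  refine h1.congr_deriv ?_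
  simp only [id]
  ring

theorem fan_deriv_pos (U : State) {τ : ℝ} (hτ : 0 < τ) : 0 < √(G.A U.S) * -(τ * G.dk τ) :=
  mul_pos (G.sqrtA_pos _) (neg_pos.2 (mul_neg_of_pos_of_neg hτ (G.dk_neg τ hτ)))

theorem continuousOn_fan (U : State) : ContinuousOn (G.fan U) (Ioi 0) := fun _ hτ =>
  (G.hasDerivAt_fan U hτ).continuousAt.continuousWithinAt

theorem strictMonoOn_fan (U : State) : StrictMonoOn (G.fan U) (Ioi 0) := by
  refine strictMonoOn_of_deriv_pos (convex_Ioi 0) (G.continuousOn_fan U) fun τ hτ => ?_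
  rw [interior_Ioi] at hτ
  rw [(G.hasDerivAt_fan U hτ).deriv]
  exact G.fan_deriv_pos U hτ

theorem tendsto_fan_atTop (U : State) : Tendsto (G.fan U) atTop atTop := by
  refine tendsto_atTop_add_const_left _ _ (Tendsto.const_mul_atTop (G.sqrtA_pos U.S) ?_)
  refine (tendsto_atTop_add_const_right _ (-G.Φ U.τ) G.tendsto_fan).congr fun τ => ?_
  ring

/-- Dividing by τ shows that the mass flux in a fan is √A k: the flow is sonic throughout. -/
theorem fanState_u_sub_fan (U : State) (τ : ℝ) :
    (G.fanState U τ).u - G.fan U τ = √(G.A U.S) * (τ * G.k τ) := by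
  simp only [fanState, fan]; ring

/-- T is the specific volume as a function of ξ: the inverse of the fan speed, frozen at a and b
outside the fan by clamping ξ. Being monotone and onto [a, b], it is continuous. -/
theorem exists_fan_inverse (U : State) {a b : ℝ} (ha : 0 < a) (hab : a ≤ b) :
    ∃ T : ℝ → ℝ, Continuous T ∧ (∀ ξ, T ξ ∈ Icc a b) ∧ (∀ ξ ≤ G.fan U a, T ξ = a) ∧
      (∀ ξ, G.fan U b ≤ ξ → T ξ = b) ∧ ∀ ξ ∈ Icc (G.fan U a) (G.fan U b), G.fan U (T ξ) = ξ := by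
  have hsub : Icc a b ⊆ Ioi 0 := fun x hx => ha.trans_le hx.1
  have hfab : G.fan U a ≤ G.fan U b :=
    (G.strictMonoOn_fan U).monotoneOn ha (ha.trans_le hab) hab
  have hex : ∀ ξ, ∃ τ ∈ Icc a b, G.fan U τ = projIcc _ _ hfab ξ := fun ξ =>
    intermediate_value_Icc hab ((G.continuousOn_fan U).mono hsub) (projIcc _ _ hfab ξ).2
  choose T hT hfT using hex
  have hinj : ∀ ξ, ∀ τ ∈ Icc a b, G.fan U τ = projIcc _ _ hfab ξ → T ξ = τ := fun ξ τ hτ h =>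
    (G.strictMonoOn_fan U).injOn (hsub (hT ξ)) (hsub hτ) ((hfT ξ).trans h.symm)
  let T' : ℝ → Icc a b := fun ξ => ⟨T ξ, hT ξ⟩
  have hmono : Monotone T' := fun ξ η h => by
    refine Subtype.mk_le_mk.2 (((G.strictMonoOn_fan U).le_iff_le (hsub (hT ξ)) (hsub (hT η))).1 ?_)
    rw [hfT, hfT]
    exact monotone_projIcc hfab h
  have hsurj : Function.Surjective T' := by
    rintro ⟨τ, hτ⟩
    refine ⟨G.fan U τ, Subtype.ext (hinj _ τ hτ ?_)⟩
    rw [projIcc_of_mem hfab ⟨(G.strictMonoOn_fan U).monotoneOn ha (hsub hτ) hτ.1,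
      (G.strictMonoOn_fan U).monotoneOn (hsub hτ) (ha.trans_le hab) hτ.2⟩]
  refine ⟨T, continuous_subtype_val.comp (hmono.continuous_of_surjective hsurj), hT, ?_, ?_, ?_⟩
  · intro ξ hξ
    exact hinj ξ a ⟨le_rfl, hab⟩ (by rw [projIcc_of_le_left hfab hξ])
  · intro ξ hξ
    exact hinj ξ b ⟨hab, le_rfl⟩ (by rw [projIcc_of_right_le hfab hξ])
  · intro ξ hξ
    rw [hfT, projIcc_of_mem hfab hξ]

theorem smoothAt_of_eventually_eq {V : ℝ → State} {W : State} {ξ : ℝ} (hW : 0 < W.ρ)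
    (hV : ∀ᶠ η in 𝓝 ξ, V η = W) : SmoothAt G.E V ξ := by
  refine SmoothAt.congr (V := fun _ => W) (Or.inr ⟨hW, contDiffAt_const, contDiffAt_const,
    contDiffAt_const, fun t x ht hx => ?_⟩) hV
  rw [G.eulerAt_iff ht hW (hasDerivAt_const _ _) (hasDerivAt_const _ _) (hasDerivAt_const _ _)]
  simp

/-- The inverse T is differentiable because the fan speed has derivative −√A τ k′ > 0, and since m =
C the relations u′ = m τ′ and m u′ = C² τ′ are the same. -/
theorem smoothAt_fanState (U : State) {T : ℝ → ℝ} (hT : Continuous T) (hpos : ∀ ξ, 0 < T ξ)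
    {ξ : ℝ} (h : ∀ᶠ η in 𝓝 ξ, G.fan U (T η) = η) :
    SmoothAt G.E (fun η => G.fanState U (T η)) ξ := by
  set D : ℝ → ℝ := fun η => (√(G.A U.S) * -(T η * G.dk (T η)))⁻¹ with hD
  have hTd : ∀ᶠ η in 𝓝 ξ, HasDerivAt T (D η) η := by
    filter_upwards [h.eventually_nhds] with η hη
    exact (G.hasDerivAt_fan U (hpos η)).of_local_left_inverse hT.continuousAt
      (G.fan_deriv_pos U (hpos η)).ne' hη
  have hcomp : ∀ {f : ℝ → ℝ}, ContinuousOn f (Ioi 0) → Continuous fun η => f (T η) := fun hf =>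
    hf.comp_continuous hT hpos
  have hDc : Continuous D := by
    have h1 := hcomp G.continuousOn_dk
    exact (continuous_const.mul (hT.mul h1).neg).inv₀ fun η => (G.fan_deriv_pos U (hpos η)).ne'
  have hkc := hcomp G.continuousOn_k
  have hud : ∀ᶠ η in 𝓝 ξ, HasDerivAt (fun η => (G.fanState U (T η)).u)
      (√(G.A U.S) * (G.k (T η) * D η)) η := by
    filter_upwards [hTd] with η hη
    exact ((((G.hasDerivAt_Φ _ (hpos η)).comp η hη).sub_const _).const_mul _).const_add _
  have hρd : ∀ᶠ η in 𝓝 ξ, HasDerivAt (fun η => (G.fanState U (T η)).ρ)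
      (-D η / T η ^ 2) η := by
    filter_upwards [hTd] with η hη
    have h1 : HasDerivAt (fun η => (T η)⁻¹) (-D η / T η ^ 2) η := hη.inv (hpos η).ne'
    simpa [fanState, one_div] using h1
  refine Or.inr ⟨one_div_pos.2 (hpos ξ), contDiffAt_one_of_hasDerivAt hρd ?_,
    contDiffAt_one_of_hasDerivAt hud ?_, contDiffAt_const, fun t x ht hx => ?_⟩
  · exact .of_forall fun η => (hDc.neg.div (hT.pow 2)
      fun η => (pow_pos (hpos η) 2).ne').continuousAt
  · exact .of_forall fun η => (continuous_const.mul (hkc.mul hDc)).continuousAt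
  · have e : (fun η => (G.fanState U (T η)).τ) = T := funext fun η => G.fanState_τ U _
    subst hx
    have hm : (G.fanState U (T (x / t))).ρ * ((G.fanState U (T (x / t))).u - x / t)
        = √(G.A U.S) * G.k (T (x / t)) := by
      have h1 := G.fanState_u_sub_fan U (T (x / t))
      rw [h.self_of_nhds] at h1
      rw [h1]
      have := (hpos (x / t)).ne'
      simp only [fanState]
      field_simp
    rw [G.eulerAt_iff ht (one_div_pos.2 (hpos _)) (by rw [e]; exact hTd.self_of_nhds)
      hud.self_of_nhds (hasDerivAt_const _ _), hm, sq_C, fanState_τ]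
    have hA := G.sq_sqrtA U.S
    refine ⟨by ring, ?_, by ring⟩
    simp only [fanState]
    linear_combination (G.k (T (x / t)) ^ 2 * D (x / t)) * hA

variable {G}

theorem IsRarefaction.exists_profile {U W : State} (h : G.IsRarefaction U W) :
    ∃ (V : ℝ → State) (b : ℝ), b < W.u ∧ (∀ ξ, b ≤ ξ → V ξ = W) ∧
      IsRiemannSolution G.E U W V ∧ ∃ δ, 0 < δ ∧ ∀ ξ, δ ≤ (V ξ).ρ := by
  have hU := State.τ_pos h.ahead
  have hW := State.τ_pos h.behind
  obtain ⟨T, hTc, hTm, hTa, hTb, hTf⟩ := G.exists_fan_inverse U hU h.expansive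
  have hpos : ∀ ξ, 0 < T ξ := fun ξ => hU.trans_le (hTm ξ).1
  have hVa : ∀ ξ ≤ G.fan U U.τ, G.fanState U (T ξ) = U := fun ξ hξ => by
    rw [hTa ξ hξ, fanState_self]
  have hVb : ∀ ξ, G.fan U W.τ ≤ ξ → G.fanState U (T ξ) = W := fun ξ hξ => by
    rw [hTb ξ hξ, ← h.eq_fanState]
  refine ⟨fun ξ => G.fanState U (T ξ), G.fan U W.τ, ?_, hVb, ?_, 1 / W.τ, one_div_pos.2 hW,
    fun ξ => one_div_le_one_div_of_le (hpos ξ) (hTm ξ).2⟩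
  · have h1 := G.fanState_u_sub_fan U W.τ
    rw [← h.eq_fanState] at h1
    have := mul_pos (G.sqrtA_pos U.S) (mul_pos hW (G.k_pos _ hW))
    linarith
  · refine IsRiemannSolution.mk_of_smoothAt (fun ξ => (one_div_pos.2 (hpos ξ)).le)
      (tendsToState_of_eventually_eq ?_) (tendsToState_of_eventually_eq ?_)
      {G.fan U U.τ, G.fan U W.τ} (fun ξ hξ => ?_) fun s _ => ?_
    · filter_upwards [eventually_le_atBot (G.fan U U.τ)] with ξ hξ using hVa ξ hξ
    · filter_upwards [eventually_ge_atTop (G.fan U W.τ)] with ξ hξ using hVb ξ hξ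
    · simp only [Finset.mem_insert, Finset.mem_singleton, not_or] at hξ
      rcases lt_or_gt_of_ne hξ.1 with h1 | h1
      · refine G.smoothAt_of_eventually_eq h.ahead ?_
        filter_upwards [gt_mem_nhds h1] with η hη using hVa η hη.le
      rcases lt_or_gt_of_ne hξ.2 with h2 | h2
      · refine G.smoothAt_fanState U hTc hpos ?_
        filter_upwards [Ioo_mem_nhds h1 h2] with η hη using hTf η ⟨hη.1.le, hη.2.le⟩
      · refine G.smoothAt_of_eventually_eq h.behind ?_
        filter_upwards [lt_mem_nhds h2] with η hη using hVb η hη.le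
    -- The profile is continuous at the edges of the fan, so they are trivial jumps.
    · have hc : ∀ l ≤ 𝓝 s, TendsToState (fun ξ => G.fanState U (T ξ)) l (G.fanState U (T s)) := by
        intro l hl
        refine tendsToState_of_continuousAt (V := fun ξ => G.fanState U (T ξ)) ?_ ?_ ?_ hl
        · exact (continuous_const.div hTc fun η => (hpos η).ne').continuousAt
        · have := G.continuousOn_Φ.comp_continuous hTc hpos
          exact (continuous_const.add (continuous_const.mul (this.sub continuous_const))).continuousAt
        · exact continuousAt_const
      exact JumpAt.of_tendsToState (hc _ nhdsWithin_le_nhds) (hc _ nhdsWithin_le_nhds)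

theorem IsShock.exists_profile {U W : State} {m : ℝ} (h : G.IsShock U W m) :
    ∃ (V : ℝ → State) (b : ℝ), b < W.u ∧ (∀ ξ, b ≤ ξ → V ξ = W) ∧
      IsRiemannSolution G.E U W V ∧ ∃ δ, 0 < δ ∧ ∀ ξ, δ ≤ (V ξ).ρ := by
  set s := U.u - m * U.τ with hs
  obtain ⟨hRH, hm⟩ := h.rankineHugoniot
  have eL : ∀ ξ < s, (if ξ < s then U else W) = U := fun ξ hξ => if_pos hξ
  have eR : ∀ ξ, s ≤ ξ → (if ξ < s then U else W) = W := fun ξ hξ => if_neg hξ.not_gt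
  have hmin : ∀ ξ, min U.ρ W.ρ ≤ (if ξ < s then U else W).ρ := fun ξ => by
    split_ifs
    exacts [min_le_left _ _, min_le_right _ _]
  have hδ : 0 < min U.ρ W.ρ := lt_min h.ahead h.behind
  refine ⟨fun ξ => if ξ < s then U else W, s, ?_, eR, ?_, _, hδ, hmin⟩
  · have h1 := h.velocity
    have h2 := mul_pos h.m_pos (State.τ_pos h.behind)
    rw [hs]; linarith
  · refine IsRiemannSolution.mk_of_smoothAt (fun ξ => hδ.le.trans (hmin ξ))
      (tendsToState_of_eventually_eq ?_) (tendsToState_of_eventually_eq ?_)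
      {s} (fun ξ hξ => ?_) fun s' hs' => ?_
    · filter_upwards [eventually_lt_atBot s] with ξ hξ using eL ξ hξ
    · filter_upwards [eventually_ge_atTop s] with ξ hξ using eR ξ hξ
    · rw [Finset.mem_singleton] at hξ
      rcases lt_or_gt_of_ne hξ with h1 | h1
      · refine G.smoothAt_of_eventually_eq h.ahead ?_
        filter_upwards [gt_mem_nhds h1] with η hη using eL η hη
      · refine G.smoothAt_of_eventually_eq h.behind ?_
        filter_upwards [lt_mem_nhds h1] with η hη using eR η hη.le
    · rw [Finset.mem_singleton] at hs'
      subst hs'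
      refine ⟨U, W, tendsToState_of_eventually_eq ?_, tendsToState_of_eventually_eq ?_, hRH, ?_⟩
      · filter_upwards [self_mem_nhdsWithin] with ξ hξ using eL ξ hξ
      · filter_upwards [self_mem_nhdsWithin] with ξ hξ using eR ξ (le_of_lt hξ)
      · constructor
        · intro _
          rw [G.p_eq h.ahead, G.p_eq h.behind]
          exact h.compressive.le
        · intro h'
          rw [hm] at h'
          exact absurd h' h.m_pos.not_gt

/-- The strict inequality b < W.u leaves a constant zone between the wave and the particle path ξ =
W.u, where the contact discontinuity will be placed. -/
theorem OnWaveCurve.exists_profile {U W : State} (h : G.OnWaveCurve U W) :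
    ∃ (V : ℝ → State) (b : ℝ), b < W.u ∧ (∀ ξ, b ≤ ξ → V ξ = W) ∧
      IsRiemannSolution G.E U W V ∧ ∃ δ, 0 < δ ∧ ∀ ξ, δ ≤ (V ξ).ρ := by
  rcases h with h | ⟨m, h⟩
  exacts [IsRarefaction.exists_profile h, IsShock.exists_profile h]

theorem P_refl (W : State) : G.P W.refl = G.P W := rfl

/-- The backward wave from UL and the mirrored backward wave from `UR.refl` are joined along ξ =
W.u. Pressures and velocities agree there and no gas crosses, so the Rankine–Hugoniot conditions
hold and the entropy condition is void. -/
theorem exists_isRiemannSolution {UL UR : State} (hL : 0 < UL.ρ) (hR : 0 < UR.ρ) :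
    ∃ V, IsRiemannSolution G.E UL UR V ∧ ∃ δ, 0 < δ ∧ ∀ ξ, δ ≤ (V ξ).ρ := by
  obtain ⟨W, W', hW, hW', hP, hu⟩ :=
    exists_intersection (G := G) hL (U' := UR.refl) hR
  obtain ⟨V, b, hb, hV, hsol, δ, hδ, hVδ⟩ := hW.exists_profile
  obtain ⟨V', b', hb', hV', hsol', δ', hδ', hVδ'⟩ := hW'.exists_profile
  have hsol'' := hsol'.reflect
  rw [State.refl_refl] at hsol''
  have hu' : W'.refl.u = W.u := by simp [State.refl, hu]
  have hWpos := hW.behind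
  have hWpos' : 0 < W'.refl.ρ := hW'.behind
  refine ⟨_, hsol.glue hsol'' hb (b' := -b') (by linarith) hV (fun ξ hξ => ?_) ?_ ?_,
    min δ δ', lt_min hδ hδ', fun ξ => ?_⟩
  · simp only [reflProfile]
    rw [hV' _ (by linarith)]
  · rw [G.rankineHugoniot_iff hWpos hWpos', hu', P_refl, hP]
    simp
  · constructor <;> intro h <;> simp at h
  · split_ifs
    · exact (min_le_left _ _).trans (hVδ ξ)
    · exact (min_le_right _ _).trans (hVδ' (-ξ))

end GasLaw

/-! ### Real-variable tools -/

theorem eventually_notMem_finset (Z : Finset ℝ) (x : ℝ) : ∀ᶠ ξ in 𝓝[≠] x, ξ ∉ Z := by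
  have : ∀ᶠ ξ in 𝓝[≠] x, ∀ z ∈ Z, ξ ≠ z := by
    refine (Filter.eventually_all_finset Z).2 fun z _ => ?_
    rcases eq_or_ne x z with rfl | h
    · exact self_mem_nhdsWithin
    · exact nhdsWithin_le_nhds (isOpen_ne.mem_nhds h)
  filter_upwards [this] with ξ h hξ using h ξ hξ rfl

theorem eventually_notMem_finset_right (Z : Finset ℝ) (x : ℝ) : ∀ᶠ ξ in 𝓝[>] x, ξ ∉ Z :=
  (eventually_notMem_finset Z x).filter_mono (nhdsWithin_mono _ fun _ h => ne_of_gt h)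

theorem eventually_notMem_finset_left (Z : Finset ℝ) (x : ℝ) : ∀ᶠ ξ in 𝓝[<] x, ξ ∉ Z :=
  (eventually_notMem_finset Z x).filter_mono (nhdsWithin_mono _ fun _ h => ne_of_lt h)

theorem eventually_notMem_finset_self {Z : Finset ℝ} {x : ℝ} (hx : x ∉ Z) :
    ∀ᶠ ξ in 𝓝 x, ξ ∉ Z :=
  Z.finite_toSet.isClosed.compl_mem_nhds hx

theorem eventually_notMem_finset_atBot (Z : Finset ℝ) : ∀ᶠ ξ in atBot, ξ ∉ Z := by
  have : ∀ᶠ ξ in atBot, ∀ z ∈ Z, ξ ≠ z :=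
    (Filter.eventually_all_finset Z).2 fun z _ => eventually_ne_atBot z
  filter_upwards [this] with ξ h hξ using h ξ hξ rfl

theorem exists_notMem_finset (Z : Finset ℝ) {x y : ℝ} (h : x < y) : ∃ ξ ∈ Ioo x y, ξ ∉ Z :=
  (Filter.Eventually.and (Ioo_mem_nhdsGT h) (eventually_notMem_finset_right Z x)).exists

/-- A continuous function is decreasing if its derivative is negative off a finite set. -/
theorem lt_of_hasDerivAt_neg_off_finset {f f' : ℝ → ℝ} (hf : Continuous f) (Z : Finset ℝ) :
    ∀ {x y : ℝ}, x < y → (∀ z ∈ Ioo x y, z ∉ Z → HasDerivAt f (f' z) z ∧ f' z < 0) → f y < f x := by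
  induction Z using Finset.induction_on with
  | empty =>
    intro x y hxy h
    refine strictAntiOn_of_deriv_neg (convex_Icc x y) hf.continuousOn (fun z hz => ?_)
      (left_mem_Icc.2 hxy.le) (right_mem_Icc.2 hxy.le) hxy
    rw [interior_Icc] at hz
    obtain ⟨h1, h2⟩ := h z hz (Finset.notMem_empty z)
    rwa [h1.deriv]
  | insert w Z _ ih =>
    intro x y hxy h
    by_cases hw : w ∈ Ioo x y
    · refine (ih hw.2 fun z hz hzZ => h z ⟨hw.1.trans hz.1, hz.2⟩ ?_).trans
        (ih hw.1 fun z hz hzZ => h z ⟨hz.1, hz.2.trans hw.2⟩ ?_)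
      · simp [hzZ, hz.1.ne']
      · simp [hzZ, hz.2.ne]
    · refine ih hxy fun z hz hzZ => h z hz ?_
      have : z ≠ w := fun e => hw (e ▸ hz)
      simp [hzZ, this]

theorem antitone_of_hasDerivAt_nonpos_off_finset {f f' : ℝ → ℝ} (hf : Continuous f) (Z : Finset ℝ)
    (h : ∀ z ∉ Z, HasDerivAt f (f' z) z ∧ f' z ≤ 0) : Antitone f := by
  intro x y hxy
  rcases hxy.eq_or_lt with rfl | hlt
  · exact le_rfl
  refine le_of_forall_pos_le_add fun ε hε => ?_
  have hd := sub_pos.2 hlt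
  -- Tilting by slope ε/(y − x) makes the derivative strictly negative and costs exactly ε between x
  -- and y.
  have h1 := lt_of_hasDerivAt_neg_off_finset (f := fun z => f z - ε / (y - x) * z)
    (f' := fun z => f' z - ε / (y - x)) (by fun_prop) Z hlt fun z _ hz => ?_
  · have : ε / (y - x) * (y - x) = ε := div_mul_cancel₀ _ hd.ne'
    linarith
  · refine ⟨?_, ?_⟩
    · exact ((h z hz).1.sub ((hasDerivAt_id z).const_mul (ε / (y - x)))).congr_deriv (by simp)
    · have := (h z hz).2
      have := div_pos hε hd
      linarith

/-- Real induction: at the infimum of the failures, Q persists a little further to the right, which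
is absurd. It carries a property across jumps without listing them in order. -/
theorem forall_Ioo_of_continuation {Q : ℝ → Prop} {s t : ℝ} (h0 : ∀ᶠ ξ in 𝓝[>] s, Q ξ)
    (h : ∀ x ∈ Ioo s t, (∀ η ∈ Ioo s x, Q η) → Q x ∧ ∀ᶠ η in 𝓝[>] x, Q η) :
    ∀ x ∈ Ioo s t, Q x := by
  intro y hy
  by_contra hQ
  set B := {x | x ∈ Ioo s t ∧ ¬ Q x} with hB
  have hne : B.Nonempty := ⟨y, hy, hQ⟩
  have hbd : BddBelow B := ⟨s, fun x hx => hx.1.1.le⟩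
  have hlow : ∀ η ∈ Ioo s (sInf B), Q η := fun η hη => by
    by_contra hc
    exact (csInf_le hbd ⟨⟨hη.1, hη.2.trans_le ((csInf_le hbd ⟨hy, hQ⟩).trans hy.2.le)⟩, hc⟩).not_gt
      hη.2
  have hle : sInf B ≤ y := csInf_le hbd ⟨hy, hQ⟩
  have hs : s ≤ sInf B := le_csInf hne fun x hx => hx.1.1.le
  have key : (∀ᶠ η in 𝓝[>] sInf B, Q η) ∧ (sInf B = s ∨ Q (sInf B)) := by
    rcases hs.eq_or_lt with e | hlt
    · rw [← e]; exact ⟨h0, Or.inl rfl⟩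
    · have := h _ ⟨hlt, hle.trans_lt hy.2⟩ hlow
      exact ⟨this.2, Or.inr this.1⟩
  obtain ⟨u, hu, hsub⟩ := (mem_nhdsGT_iff_exists_Ioo_subset).1 key.1
  obtain ⟨b, hb, hbu⟩ := exists_lt_of_csInf_lt hne hu
  rcases (csInf_le hbd hb).eq_or_lt with e | hlt
  · rcases key.2 with h1 | h1
    · exact hb.1.1.ne (by rw [← h1, e])
    · exact hb.2 (e ▸ h1)
  · exact hb.2 (hsub ⟨hlt, hbu⟩)

theorem forall_Ioo_of_continuation_left {Q : ℝ → Prop} {s t : ℝ} (h0 : ∀ᶠ ξ in 𝓝[<] t, Q ξ)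
    (h : ∀ x ∈ Ioo s t, (∀ η ∈ Ioo x t, Q η) → Q x ∧ ∀ᶠ η in 𝓝[<] x, Q η) :
    ∀ x ∈ Ioo s t, Q x := by
  intro x hx
  have := forall_Ioo_of_continuation (Q := fun ξ => Q (-ξ)) (s := -t) (t := -s)
    (tendsto_neg_nhdsGT_neg.eventually h0) (fun y hy hQ => ?_) (-x) ⟨by linarith [hx.2], by linarith [hx.1]⟩
  · simpa using this
  · obtain ⟨h1, h2⟩ := h (-y) ⟨by linarith [hy.2], by linarith [hy.1]⟩ fun η hη => by
      simpa using hQ (-η) ⟨by linarith [hη.2], by linarith [hη.1]⟩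
    exact ⟨h1, tendsto_neg_nhdsGT.eventually h2⟩

/-! ### Limits of profiles at positive density -/

/-- All components of the profile converge. -/
structure Converges (V : ℝ → State) (l : Filter ℝ) (W : State) : Prop where
  ρ : Tendsto (fun ξ => (V ξ).ρ) l (𝓝 W.ρ)
  u : Tendsto (fun ξ => (V ξ).u) l (𝓝 W.u)
  S : Tendsto (fun ξ => (V ξ).S) l (𝓝 W.S)

theorem TendsToState.converges {V : ℝ → State} {l : Filter ℝ} [NeBot l] {W : State}
    (h : TendsToState V l W) (hW : W.ρ ≠ 0) : Converges V l W := by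
  have hn : ¬ ∀ᶠ ξ in l, (V ξ).ρ = 0 := fun hv =>
    hW (tendsto_nhds_unique h.1 (tendsto_const_nhds.congr' (by
      filter_upwards [hv] with ξ hξ using hξ.symm)))
  exact ⟨h.1, (h.2 hn).1, (h.2 hn).2⟩

/-- In vacuum the velocity need not converge, but the factor ρ = 0 does; the mass flux is thus
meaningful everywhere. -/
theorem TendsToState.tendsto_flux {V : ℝ → State} {l : Filter ℝ} [NeBot l] {W : State} {s : ℝ}
    (h : TendsToState V l W) (hl : l ≤ 𝓝 s) :
    Tendsto (fun ξ => (V ξ).ρ * ((V ξ).u - ξ)) l (𝓝 (W.ρ * (W.u - s))) := by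
  by_cases hv : ∀ᶠ ξ in l, (V ξ).ρ = 0
  · have h0 : W.ρ = 0 := tendsto_nhds_unique h.1 (tendsto_const_nhds.congr' (by
      filter_upwards [hv] with ξ hξ using hξ.symm))
    rw [h0, zero_mul]
    refine tendsto_const_nhds.congr' ?_
    filter_upwards [hv] with ξ hξ
    rw [hξ, zero_mul]
  · exact h.1.mul ((h.2 hv).1.sub (tendsto_id.mono_left hl))

theorem Converges.tendsto_flux_atBot {V : ℝ → State} {W : State} (h : Converges V atBot W)
    (hW : 0 < W.ρ) : Tendsto (fun ξ => (V ξ).ρ * ((V ξ).u - ξ)) atBot atTop := by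
  refine h.ρ.pos_mul_atTop hW ?_
  simpa [sub_eq_add_neg] using h.u.add_atTop tendsto_neg_atBot_atTop

theorem Converges.unique {V : ℝ → State} {l : Filter ℝ} [NeBot l] {W W' : State}
    (h : Converges V l W) (h' : Converges V l W') : W = W' :=
  State.ext (tendsto_nhds_unique h.ρ h'.ρ) (tendsto_nhds_unique h.u h'.u)
    (tendsto_nhds_unique h.S h'.S)

theorem Converges.of_eventually_eq {V : ℝ → State} {l : Filter ℝ} {W : State}
    (h : ∀ᶠ ξ in l, V ξ = W) : Converges V l W := by
  have e : ∀ f : State → ℝ, Tendsto (fun ξ => f (V ξ)) l (𝓝 (f W)) := fun f =>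
    tendsto_const_nhds.congr' (by filter_upwards [h] with ξ hξ; rw [hξ])
  exact ⟨e _, e _, e _⟩

theorem Converges.τ {V : ℝ → State} {l : Filter ℝ} {W : State} (h : Converges V l W)
    (hW : 0 < W.ρ) : Tendsto (fun ξ => (V ξ).τ) l (𝓝 W.τ) :=
  tendsto_const_nhds.div h.ρ hW.ne'

theorem Converges.sound {G : GasLaw} {V : ℝ → State} {l : Filter ℝ} {W : State}
    (h : Converges V l W) (hW : 0 < W.ρ) : Tendsto (fun ξ => G.C (V ξ)) l (𝓝 (G.C W)) := by
  have h1 : Tendsto (fun ξ => G.A (V ξ).S) l (𝓝 (G.A W.S)) :=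
    (G.continuous_A.tendsto _).comp h.S
  have h2 : Tendsto (fun ξ => G.k (V ξ).τ) l (𝓝 (G.k W.τ)) :=
    Tendsto.comp (G.hasDerivAt_k _ (State.τ_pos hW)).continuousAt (h.τ hW)
  exact h1.sqrt.mul h2

/-! ### The mass flux of an arbitrary solution -/

namespace GasLaw

variable {G : GasLaw}

/-- The derivatives of a profile at a smooth point of positive density. -/
theorem SmoothAt.derivatives {V : ℝ → State} {ξ : ℝ} (h : SmoothAt G.E V ξ) (hpos : (V ξ).ρ ≠ 0) :
    0 < (V ξ).ρ ∧ ∃ T v z, HasDerivAt (fun η => (V η).τ) T ξ ∧ HasDerivAt (fun η => (V η).u) v ξ ∧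
      HasDerivAt (fun η => (V η).S) z ξ ∧
      HasDerivAt (fun η => (V η).ρ * ((V η).u - η)) (-(V ξ).ρ) ξ ∧
      v = (V ξ).ρ * ((V ξ).u - ξ) * T ∧
      (V ξ).ρ * ((V ξ).u - ξ) * v + G.dA (V ξ).S * z * G.g (V ξ).τ - G.C (V ξ) ^ 2 * T = 0 ∧
      (V ξ).ρ * ((V ξ).u - ξ) * z = 0 := by
  rcases h with h | ⟨h0, h1, h2, h3, h4⟩
  · exact absurd h.self_of_nhds hpos
  have d1 := (h1.differentiableAt one_ne_zero).hasDerivAt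
  have d2 := (h2.differentiableAt one_ne_zero).hasDerivAt
  have d3 := (h3.differentiableAt one_ne_zero).hasDerivAt
  set r := deriv (fun η => (V η).ρ) ξ
  set v := deriv (fun η => (V η).u) ξ
  set z := deriv (fun η => (V η).S) ξ
  have dτ : HasDerivAt (fun η => (V η).τ) (-r / (V ξ).ρ ^ 2) ξ := by
    have : HasDerivAt (fun η => ((V η).ρ)⁻¹) (-r / (V ξ).ρ ^ 2) ξ := d1.inv hpos
    simpa [State.τ, one_div] using this
  have e : ξ / 1 = ξ := div_one ξ
  have hE := (G.eulerAt_iff (V := V) one_pos (by rwa [e]) (by rwa [e]) (by rwa [e])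
    (by rwa [e])).1 (h4 1 ξ one_pos e)
  rw [e] at hE
  refine ⟨h0, _, v, z, dτ, d2, d3, ?_, hE⟩
  have := d1.mul (d2.sub (hasDerivAt_id ξ))
  refine this.congr_deriv ?_
  rw [hE.1]
  simp only [Pi.sub_apply, id]
  field_simp
  ring

/-- The mass flux `ρ (u - ξ)` extends continuously over the jumps, and it is nonincreasing. -/
theorem exists_massFlux {V : ℝ → State} {Z : Finset ℝ} (hρ : ∀ ξ, 0 ≤ (V ξ).ρ)
    (hS : ∀ ξ, ξ ∉ Z → SmoothAt G.E V ξ) (hJ : ∀ s, JumpAt G.E V s) :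
    ∃ M : ℝ → ℝ, Continuous M ∧ (∀ ξ ∉ Z, M ξ = (V ξ).ρ * ((V ξ).u - ξ)) ∧
      (∀ ξ ∉ Z, HasDerivAt M (-(V ξ).ρ) ξ) ∧ Antitone M := by
  choose L R hL hR hRH hE using hJ
  -- The left limits define M at every ray; the mass component of Rankine–Hugoniot says that the
  -- right limits give the same value.
  set M : ℝ → ℝ := fun s => (L s).ρ * ((L s).u - s) with hM
  have hMV : ∀ ξ ∉ Z, M ξ = (V ξ).ρ * ((V ξ).u - ξ) := fun ξ hξ =>
    tendsto_nhds_unique ((hL ξ).tendsto_flux nhdsWithin_le_nhds)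
      (((hS ξ hξ).tendsToState (l := 𝓝[<] ξ) nhdsWithin_le_nhds).tendsto_flux nhdsWithin_le_nhds)
  have hMR : ∀ s, M s = (R s).ρ * ((R s).u - s) := fun s => by
    have := hRH s 0
    simp only [density, flux, Matrix.cons_val_zero] at this
    simp only [hM]; linarith
  have hcont : Continuous M := by
    refine continuous_iff_continuousAt.2 fun s => ?_
    rw [continuousAt_iff_punctured_nhds, punctured_nhds_eq_nhdsWithin_sup_nhdsWithin]
    refine Tendsto.sup ?_ ?_
    · refine ((hL s).tendsto_flux nhdsWithin_le_nhds).congr' ?_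
      filter_upwards [eventually_notMem_finset_left Z s] with ξ hξ using (hMV ξ hξ).symm
    · rw [hMR s]
      refine ((hR s).tendsto_flux nhdsWithin_le_nhds).congr' ?_
      filter_upwards [eventually_notMem_finset_right Z s] with ξ hξ using (hMV ξ hξ).symm
  have hd : ∀ ξ ∉ Z, HasDerivAt M (-(V ξ).ρ) ξ := by
    intro ξ hξ
    have hev : M =ᶠ[𝓝 ξ] fun η => (V η).ρ * ((V η).u - η) := by
      filter_upwards [eventually_notMem_finset_self hξ] with η hη using hMV η hη
    refine HasDerivAt.congr_of_eventuallyEq ?_ hev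
    rcases hS ξ hξ with hv | h
    · have e : (fun η => (V η).ρ * ((V η).u - η)) =ᶠ[𝓝 ξ] fun _ => 0 := by
        filter_upwards [hv] with η hη
        rw [hη, zero_mul]
      rw [hv.self_of_nhds, neg_zero]
      exact (hasDerivAt_const ξ (0 : ℝ)).congr_of_eventuallyEq e
    · obtain ⟨-, T, v, z, -, -, -, hN, -⟩ := SmoothAt.derivatives (hS ξ hξ) h.1.ne'
      exact hN
  exact ⟨M, hcont, hMV, hd, antitone_of_hasDerivAt_nonpos_off_finset hcont Z fun z hz =>
    ⟨hd z hz, neg_nonpos.2 (hρ z)⟩⟩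

/-! ### Structure of a solution where the mass flux is positive -/

variable (G) in
/-- A profile on the half line `ξ < a` where gas crosses all rays from left to right. -/
structure LeftHalf (U : State) (V : ℝ → State) (Z : Finset ℝ) (M : ℝ → ℝ) (a : ℝ) : Prop where
  nonneg : ∀ ξ, 0 ≤ (V ξ).ρ
  data_pos : 0 < U.ρ
  data : TendsToState V atBot U
  smooth : ∀ ξ, ξ ∉ Z → SmoothAt G.E V ξ
  jump : ∀ s, JumpAt G.E V s
  cont : Continuous M
  flux : ∀ ξ ∉ Z, M ξ = (V ξ).ρ * ((V ξ).u - ξ)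
  deriv : ∀ ξ ∉ Z, HasDerivAt M (-(V ξ).ρ) ξ
  pos : ∀ ξ < a, 0 < M ξ
  zero : M a = 0

namespace LeftHalf

variable {U : State} {V : ℝ → State} {Z : Finset ℝ} {M : ℝ → ℝ} {a : ℝ}

theorem ρ_ne (h : G.LeftHalf U V Z M a) {ξ : ℝ} (hξ : ξ < a) (hZ : ξ ∉ Z) : (V ξ).ρ ≠ 0 := by
  intro h0
  have h1 := h.pos ξ hξ
  rw [h.flux ξ hZ, h0, zero_mul] at h1
  exact lt_irrefl _ h1

theorem ρ_pos (h : G.LeftHalf U V Z M a) {ξ : ℝ} (hξ : ξ < a) (hZ : ξ ∉ Z) : 0 < (V ξ).ρ :=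
  lt_of_le_of_ne (h.nonneg ξ) (h.ρ_ne hξ hZ).symm

/-- Since M > 0, entropy transport gives S′ = 0. Then u′ = M τ′ and M u′ = C² τ′ combine to (M −
C)(M + C) τ′ = 0, so the profile varies only at sonic points. -/
theorem derivatives (h : G.LeftHalf U V Z M a) {ξ : ℝ} (hξ : ξ < a) (hZ : ξ ∉ Z) :
    ∃ T, HasDerivAt (fun η => (V η).τ) T ξ ∧ HasDerivAt (fun η => (V η).u) (G.C (V ξ) * T) ξ ∧
      HasDerivAt (fun η => (V η).S) 0 ξ ∧ (M ξ ≠ G.C (V ξ) → T = 0) := by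
  obtain ⟨hpos, T, v, z, h1, h2, h3, -, e1, e2, e3⟩ :=
    SmoothAt.derivatives (h.smooth ξ hZ) (h.ρ_ne hξ hZ)
  rw [← h.flux ξ hZ] at e1 e2 e3
  have hM := h.pos ξ hξ
  have hC := G.C_pos hpos
  have hz : z = 0 := (mul_eq_zero.1 e3).resolve_left hM.ne'
  rw [hz] at e2 h3
  have hT : (M ξ - G.C (V ξ)) * T = 0 := by
    have : (M ξ + G.C (V ξ)) * ((M ξ - G.C (V ξ)) * T) = 0 := by
      rw [e1] at e2
      linear_combination e2
    exact (mul_eq_zero.1 this).resolve_left (by positivity)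
  refine ⟨T, h1, ?_, h3, fun hne => (mul_eq_zero.1 hT).resolve_left (sub_ne_zero.2 hne)⟩
  refine h2.congr_deriv ?_
  rw [e1]; linear_combination hT

theorem flux_lt (h : G.LeftHalf U V Z M a) {x y : ℝ} (hxy : x < y) (hy : y ≤ a) : M y < M x :=
  lt_of_hasDerivAt_neg_off_finset h.cont Z hxy fun z hz hZ =>
    ⟨h.deriv z hZ, neg_neg_of_pos (h.ρ_pos (hz.2.trans_le hy) hZ)⟩

/-- The one-sided limits at a point of the half line: they agree or form a shock. -/
theorem limits (h : G.LeftHalf U V Z M a) {s : ℝ} (hs : s < a) :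
    ∃ L R : State, 0 < L.ρ ∧ 0 < R.ρ ∧ Converges V (𝓝[<] s) L ∧ Converges V (𝓝[>] s) R ∧
      M s = L.ρ * (L.u - s) ∧ M s = R.ρ * (R.u - s) ∧ (s ∉ Z → V s = L ∧ V s = R) ∧
      (R = L ∨ G.IsShock L R (M s)) := by
  obtain ⟨L, R, hL, hR, hRH, hE⟩ := h.jump s
  have hM := h.pos s hs
  have mL : M s = L.ρ * (L.u - s) := by
    refine tendsto_nhds_unique (h.cont.continuousAt.mono_left nhdsWithin_le_nhds)
      ((hL.tendsto_flux nhdsWithin_le_nhds).congr' ?_)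
    filter_upwards [eventually_notMem_finset_left Z s] with ξ hξ using (h.flux ξ hξ).symm
  have mR : M s = R.ρ * (R.u - s) := by
    refine tendsto_nhds_unique (h.cont.continuousAt.mono_left nhdsWithin_le_nhds)
      ((hR.tendsto_flux nhdsWithin_le_nhds).congr' ?_)
    filter_upwards [eventually_notMem_finset_right Z s] with ξ hξ using (h.flux ξ hξ).symm
  have nL : L.ρ ≠ 0 := fun h0 => by rw [mL, h0, zero_mul] at hM; exact lt_irrefl _ hM
  have nR : R.ρ ≠ 0 := fun h0 => by rw [mR, h0, zero_mul] at hM; exact lt_irrefl _ hM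
  have pL : 0 < L.ρ := lt_of_le_of_ne (ge_of_tendsto' hL.1 fun ξ => h.nonneg ξ) nL.symm
  have pR : 0 < R.ρ := lt_of_le_of_ne (ge_of_tendsto' hR.1 fun ξ => h.nonneg ξ) nR.symm
  have cL := hL.converges nL
  have cR := hR.converges nR
  refine ⟨L, R, pL, pR, cL, cR, mL, mR, fun hZ => ?_, ?_⟩
  · have hn := h.ρ_ne hs hZ
    exact ⟨(((h.smooth s hZ).tendsToState nhdsWithin_le_nhds).converges hn).unique cL,
      (((h.smooth s hZ).tendsToState nhdsWithin_le_nhds).converges hn).unique cR⟩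
  · rw [mL]
    exact eq_or_isShock pL pR (mL ▸ hM) hRH hE

theorem eq_of_Ioo (h : G.LeftHalf U V Z M a) {x y : ℝ}
    (hI : ∀ ξ ∈ Ioo x y, ξ ∉ Z ∧ ξ < a ∧ M ξ ≠ G.C (V ξ)) {ξ η : ℝ} (hξ : ξ ∈ Ioo x y)
    (hη : η ∈ Ioo x y) : V ξ = V η := by
  have key : ∀ f : State → ℝ, (∀ ζ ∈ Ioo x y, HasDerivAt (fun η => f (V η)) 0 ζ) →
      f (V ξ) = f (V η) := fun f hf =>
    isOpen_Ioo.is_const_of_deriv_eq_zero isPreconnected_Ioo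
      (fun ζ hζ => (hf ζ hζ).differentiableAt.differentiableWithinAt) (fun ζ hζ => (hf ζ hζ).deriv)
      hξ hη
  refine State.ext_τ (key State.τ fun ζ hζ => ?_) (key State.u fun ζ hζ => ?_)
    (key State.S fun ζ hζ => ?_)
  all_goals
    obtain ⟨T, h1, h2, h3, h4⟩ := h.derivatives (hI ζ hζ).2.1 (hI ζ hζ).1
    have hT := h4 (hI ζ hζ).2.2
  · exact hT ▸ h1
  · exact h2.congr_deriv (by rw [hT, mul_zero])
  · exact h3

/-- A limit that is not sonic excludes sonic points nearby, and away from sonic points the profile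
is locally constant. -/
theorem eventually_eq_right (h : G.LeftHalf U V Z M a) {x : ℝ} {R : State} (hx : x < a)
    (hR : 0 < R.ρ) (hc : Converges V (𝓝[>] x) R) (hne : M x ≠ G.C R) :
    ∀ᶠ ξ in 𝓝[>] x, V ξ = R := by
  have h1 : ∀ᶠ ξ in 𝓝[>] x, ξ ∉ Z ∧ ξ < a ∧ M ξ ≠ G.C (V ξ) :=
    (eventually_notMem_finset_right Z x).and (((gt_mem_nhds hx).filter_mono nhdsWithin_le_nhds).and
      (((h.cont.continuousAt.mono_left nhdsWithin_le_nhds).sub (hc.sound hR)).eventually_ne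
        (sub_ne_zero.2 hne) |>.mono fun _ => sub_ne_zero.1))
  obtain ⟨y, hy, hsub⟩ := mem_nhdsGT_iff_exists_Ioo_subset.1 h1
  have h2 : ∀ ξ ∈ Ioo x y, V ξ = R := fun ξ hξ =>
    (Converges.of_eventually_eq (by
      filter_upwards [Ioo_mem_nhdsGT hy] with η hη using h.eq_of_Ioo hsub hη hξ)).unique hc
  filter_upwards [Ioo_mem_nhdsGT hy] with ξ hξ using h2 ξ hξ

theorem eventually_eq_left (h : G.LeftHalf U V Z M a) {x : ℝ} {L : State} (hx : x < a)
    (hL : 0 < L.ρ) (hc : Converges V (𝓝[<] x) L) (hne : M x ≠ G.C L) :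
    ∀ᶠ ξ in 𝓝[<] x, V ξ = L := by
  have h1 : ∀ᶠ ξ in 𝓝[<] x, ξ ∉ Z ∧ ξ < a ∧ M ξ ≠ G.C (V ξ) :=
    (eventually_notMem_finset_left Z x).and (((gt_mem_nhds hx).filter_mono nhdsWithin_le_nhds).and
      (((h.cont.continuousAt.mono_left nhdsWithin_le_nhds).sub (hc.sound hL)).eventually_ne
        (sub_ne_zero.2 hne) |>.mono fun _ => sub_ne_zero.1))
  obtain ⟨y, hy, hsub⟩ := mem_nhdsLT_iff_exists_Ioo_subset.1 h1
  have h2 : ∀ ξ ∈ Ioo y x, V ξ = L := fun ξ hξ =>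
    (Converges.of_eventually_eq (by
      filter_upwards [Ioo_mem_nhdsLT hy] with η hη using h.eq_of_Ioo hsub hη hξ)).unique hc
  filter_upwards [Ioo_mem_nhdsLT hy] with ξ hξ using h2 ξ hξ

/-- Behind a subsonic point the profile is constant. -/
theorem eq_of_subsonic (h : G.LeftHalf U V Z M a) {s : ℝ} {R : State} (hs : s < a)
    (hR : 0 < R.ρ) (hc : Converges V (𝓝[>] s) R) (hlt : M s < G.C R) :
    ∀ ξ ∈ Ioo s a, ξ ∉ Z → V ξ = R := by
  refine forall_Ioo_of_continuation ?_ fun x hx hQ => ?_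
  · filter_upwards [h.eventually_eq_right hs hR hc hlt.ne] with ξ hξ _ using hξ
  · obtain ⟨L', R', pL, pR, cL, cR, mL, mR, hZ, hj⟩ := h.limits hx.2
    have hL : L' = R := cL.unique (Converges.of_eventually_eq (by
      filter_upwards [Ioo_mem_nhdsLT hx.1, eventually_notMem_finset_left Z x] with η h1 h2
        using hQ η h1 h2))
    -- M has decreased and C is unchanged, so the flow is still subsonic at x, whereas a shock needs
    -- supersonic flow ahead.
    have hM : M x < G.C R := (h.flux_lt hx.1 hx.2.le).trans hlt
    have hR' : R' = R := by
      rcases hj with e | hsh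
      · rw [e, hL]
      · have := hsh.lax.1
        rw [hL] at this
        exact absurd this hM.not_gt
    refine ⟨fun hxZ => (hZ hxZ).1.trans hL, ?_⟩
    filter_upwards [h.eventually_eq_right hx.2 hR (hR' ▸ cR) hM.ne] with ξ hξ _ using hξ

/-- Ahead of a supersonic point the profile is constant. -/
theorem eq_of_supersonic (h : G.LeftHalf U V Z M a) {s : ℝ} {L : State} (hs : s < a)
    (hL : 0 < L.ρ) (hc : Converges V (𝓝[<] s) L) (hlt : G.C L < M s) :
    ∀ ξ < s, ξ ∉ Z → V ξ = L := by
  intro ξ₀ hξ₀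
  refine forall_Ioo_of_continuation_left (Q := fun ξ => ξ ∉ Z → V ξ = L) (s := ξ₀ - 1) (t := s) ?_
    (fun x hx hQ => ?_) ξ₀ ⟨by linarith, hξ₀⟩
  · filter_upwards [h.eventually_eq_left hs hL hc hlt.ne'] with ξ hξ _ using hξ
  · have hxa := hx.2.trans hs
    obtain ⟨L', R', pL, pR, cL, cR, mL, mR, hZ, hj⟩ := h.limits hxa
    have hR : R' = L := cR.unique (Converges.of_eventually_eq (by
      filter_upwards [Ioo_mem_nhdsGT hx.2, eventually_notMem_finset_right Z x] with η h1 h2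
        using hQ η h1 h2))
    -- Leftwards M increases, so x is still supersonic, whereas the state behind a shock is
    -- subsonic.
    have hM : G.C L < M x := hlt.trans (h.flux_lt hx.2 hs.le)
    have hL' : L' = L := by
      rcases hj with e | hsh
      · rw [← e, hR]
      · have := hsh.lax.2
        rw [hR] at this
        exact absurd this hM.not_gt
    refine ⟨fun hxZ => (hZ hxZ).2.trans hR, ?_⟩
    filter_upwards [h.eventually_eq_left hxa hL (hL' ▸ cL) hM.ne'] with ξ hξ _ using hξ

theorem eq_data_of_supersonic (h : G.LeftHalf U V Z M a) {s : ℝ} (hs : s < a) (hZ : s ∉ Z)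
    (hlt : G.C (V s) < M s) : V s = U ∧ ∀ ξ < s, ξ ∉ Z → V ξ = U := by
  obtain ⟨L, R, pL, pR, cL, cR, mL, mR, hV, hj⟩ := h.limits hs
  obtain ⟨e, -⟩ := hV hZ
  have h1 := h.eq_of_supersonic hs pL cL (e ▸ hlt)
  have h2 : L = U := by
    refine (Converges.of_eventually_eq ?_).unique (h.data.converges h.data_pos.ne')
    filter_upwards [eventually_lt_atBot s, eventually_notMem_finset_atBot Z] with ξ h3 h4
      using h1 ξ h3 h4
  exact ⟨e.trans h2, fun ξ h3 h4 => (h1 ξ h3 h4).trans h2⟩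

/-- As ξ → −∞ the mass flux tends to +∞ while C tends to its value at the data. -/
theorem exists_supersonic (h : G.LeftHalf U V Z M a) : ∃ s < a, s ∉ Z ∧ G.C (V s) < M s := by
  have hc := h.data.converges h.data_pos.ne'
  have h1 := hc.tendsto_flux_atBot h.data_pos
  have h2 := (hc.sound (G := G) h.data_pos).eventually (gt_mem_nhds (lt_add_one (G.C U)))
  obtain ⟨ξ, h3, h4, h5, h6⟩ := ((eventually_lt_atBot a).and
    ((eventually_notMem_finset_atBot Z).and (h2.and (h1.eventually_ge_atTop (G.C U + 1))))).exists
  refine ⟨ξ, h3, h4, h5.trans_le ?_⟩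
  rw [h.flux ξ h4]
  exact h6

/-- In a sonic interval behind the data the profile is a rarefaction fan. -/
theorem eq_fanState_of_sonic (h : G.LeftHalf U V Z M a) {s t : ℝ} (ht : t ≤ a) (hs : s < a)
    (hc : Converges V (𝓝[>] s) U) (hson : ∀ ξ ∈ Ioo s t, ξ ∉ Z → M ξ = G.C (V ξ)) :
    ∀ ξ ∈ Ioo s t, ξ ∉ Z → V ξ = G.fanState U (V ξ).τ := by
  -- The Riemann invariant of a backward fan: it is constant once S is, because u′ = C τ′.
  set j : State → ℝ := fun W => W.u - √(G.A U.S) * G.Φ W.τ with hj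
  have hjc : ∀ {l : Filter ℝ} {W : State}, 0 < W.ρ → Converges V l W →
      Tendsto (fun ξ => j (V ξ)) l (𝓝 (j W)) := fun hW hl =>
    hl.u.sub ((Tendsto.comp (G.hasDerivAt_Φ _ (State.τ_pos hW)).continuousAt (hl.τ hW)).const_mul _)
  have hloc : ∀ x < a, ∀ R : State, 0 < R.ρ → Converges V (𝓝[>] x) R → R.S = U.S → j R = j U →
      ∀ᶠ ξ in 𝓝[>] x, (V ξ).S = U.S ∧ j (V ξ) = j U := by
    intro x hx R hR hcR hRS hRj
    have h1 : ∀ᶠ ξ in 𝓝[>] x, ξ ∉ Z ∧ ξ < a :=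
      (eventually_notMem_finset_right Z x).and ((gt_mem_nhds hx).filter_mono nhdsWithin_le_nhds)
    obtain ⟨y, hy, hsub⟩ := mem_nhdsGT_iff_exists_Ioo_subset.1 h1
    have key : ∀ f : State → ℝ, (∀ ζ ∈ Ioo x y, HasDerivAt (fun η => f (V η)) 0 ζ) →
        Tendsto (fun ξ => f (V ξ)) (𝓝[>] x) (𝓝 (f R)) → ∀ ξ ∈ Ioo x y, f (V ξ) = f R := by
      intro f hf hfR ξ hξ
      refine tendsto_nhds_unique (tendsto_const_nhds.congr' ?_) hfR
      filter_upwards [Ioo_mem_nhdsGT hy] with η hη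
      exact isOpen_Ioo.is_const_of_deriv_eq_zero isPreconnected_Ioo
        (fun ζ hζ => (hf ζ hζ).differentiableAt.differentiableWithinAt)
        (fun ζ hζ => (hf ζ hζ).deriv) hξ hη
    have hSc : ∀ ξ ∈ Ioo x y, (V ξ).S = R.S := key State.S (fun ζ hζ => by
      obtain ⟨T, h1, h2, h3, h4⟩ := h.derivatives (hsub hζ).2 (hsub hζ).1
      exact h3) hcR.S
    have hjR : ∀ ξ ∈ Ioo x y, j (V ξ) = j R := key j (fun ζ hζ => by
      obtain ⟨T, h1, h2, h3, h4⟩ := h.derivatives (hsub hζ).2 (hsub hζ).1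
      have hτ := State.τ_pos (h.ρ_pos (hsub hζ).2 (hsub hζ).1)
      have h5 : HasDerivAt (fun η => G.Φ (V η).τ) (G.k (V ζ).τ * T) ζ :=
        HasDerivAt.comp (h := fun η => (V η).τ) ζ (G.hasDerivAt_Φ _ hτ) h1
      refine (h2.sub (h5.const_mul (√(G.A U.S)))).congr_deriv ?_
      unfold C
      rw [hSc ζ hζ, hRS]
      ring) (hjc hR hcR)
    filter_upwards [Ioo_mem_nhdsGT hy] with ξ hξ
    exact ⟨(hSc ξ hξ).trans hRS, (hjR ξ hξ).trans hRj⟩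
  have main : ∀ ξ ∈ Ioo s t, ξ ∉ Z → (V ξ).S = U.S ∧ j (V ξ) = j U := by
    refine forall_Ioo_of_continuation ?_ fun x hx hQ => ?_
    · filter_upwards [hloc s hs U h.data_pos hc rfl rfl] with ξ hξ _ using hξ
    · have hxa := hx.2.trans_le ht
      obtain ⟨L, R, pL, pR, cL, cR, mL, mR, hZ, hjump⟩ := h.limits hxa
      have hev : ∀ᶠ η in 𝓝[<] x, η ∈ Ioo s x ∧ η ∉ Z :=
        Filter.Eventually.and (Ioo_mem_nhdsLT hx.1) (eventually_notMem_finset_left Z x)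
      have e1 : L.S = U.S := tendsto_nhds_unique cL.S (tendsto_const_nhds.congr' (by
        filter_upwards [hev] with η hη using (hQ η hη.1 hη.2).1.symm))
      have e2 : j L = j U := tendsto_nhds_unique (hjc pL cL) (tendsto_const_nhds.congr' (by
        filter_upwards [hev] with η hη using (hQ η hη.1 hη.2).2.symm))
      -- The limit from the left is exactly sonic, whereas a shock needs strictly supersonic flow
      -- ahead; hence there is no jump at x.
      have e3 : M x = G.C L := tendsto_nhds_unique
        (h.cont.continuousAt.mono_left nhdsWithin_le_nhds) ((cL.sound pL).congr' (by
          filter_upwards [hev] with η hη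
            using (hson η ⟨hη.1.1, hη.1.2.trans hx.2⟩ hη.2).symm))
      have hRL : R = L := by
        rcases hjump with e | hsh
        · exact e
        · exact absurd e3 hsh.lax.1.ne'
      subst hRL
      refine ⟨fun hxZ => ?_, ?_⟩
      · rw [(hZ hxZ).1]; exact ⟨e1, e2⟩
      · filter_upwards [hloc x hxa R pR cR e1 e2] with ξ hξ _ using hξ
  intro ξ hξ hZ
  obtain ⟨h1, h2⟩ := main ξ hξ hZ
  refine State.ext_τ (by rw [fanState_τ]) ?_ h1
  simp only [hj] at h2
  simp only [fanState]
  linear_combination h2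

end LeftHalf

/-! ### Classification as a single backward wave -/

variable (G) in
/-- Off `Z` and on the half line `ξ < a`, the profile `V` is the backward wave from `U` to `W`. -/
def IsBackwardWave (U W : State) (V : ℝ → State) (Z : Finset ℝ) (a : ℝ) : Prop :=
  (G.IsRarefaction U W ∧ ∀ ξ < a, ξ ∉ Z →
    (ξ < G.fan U U.τ → V ξ = U) ∧ (G.fan U W.τ < ξ → V ξ = W) ∧
    (G.fan U U.τ < ξ → ξ < G.fan U W.τ → ∃ τ, 0 < τ ∧ G.fan U τ = ξ ∧ V ξ = G.fanState U τ)) ∨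
  ∃ m, G.IsShock U W m ∧ ∀ ξ < a, ξ ∉ Z →
    (ξ < U.u - m * U.τ → V ξ = U) ∧ (U.u - m * U.τ < ξ → V ξ = W)

theorem IsBackwardWave.onWaveCurve {U W : State} {V : ℝ → State} {Z : Finset ℝ} {a : ℝ}
    (h : G.IsBackwardWave U W V Z a) : G.OnWaveCurve U W :=
  h.imp (fun h => h.1) fun ⟨m, h⟩ => ⟨m, h.1⟩

theorem isBackwardWave_self {U : State} {V : ℝ → State} {Z : Finset ℝ} {a : ℝ} (hU : 0 < U.ρ)
    (h : ∀ ξ < a, ξ ∉ Z → V ξ = U) : G.IsBackwardWave U U V Z a :=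
  Or.inl ⟨⟨hU, hU, rfl, le_rfl, by simp⟩, fun ξ hξ hZ =>
    ⟨fun _ => h ξ hξ hZ, fun _ => h ξ hξ hZ, fun h1 h2 => absurd h1 h2.not_gt⟩⟩

/-- The end states determine the wave: the pressure jump decides its kind, m² (U.τ − W.τ) = P_W −
P_U fixes the shock speed, and injectivity of the fan speed fixes the states inside a fan. -/
theorem IsBackwardWave.exists_finset_eq {U W : State} {V V' : ℝ → State} {Z Z' : Finset ℝ} {a : ℝ}
    (h : G.IsBackwardWave U W V Z a) (h' : G.IsBackwardWave U W V' Z' a) :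
    ∃ F : Finset ℝ, ∀ ξ < a, ξ ∉ F → V ξ = V' ξ := by
  rcases h with ⟨h1, h⟩ | ⟨m, h1, h⟩ <;> rcases h' with ⟨h1', h'⟩ | ⟨m', h1', h'⟩
  · refine ⟨Z ∪ Z' ∪ {G.fan U U.τ, G.fan U W.τ}, fun ξ hξ hF => ?_⟩
    simp only [Finset.mem_union, Finset.mem_insert, Finset.mem_singleton, not_or] at hF
    obtain ⟨⟨hZ, hZ'⟩, n1, n2⟩ := hF
    obtain ⟨a1, a2, a3⟩ := h ξ hξ hZ
    obtain ⟨b1, b2, b3⟩ := h' ξ hξ hZ'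
    rcases lt_or_gt_of_ne n1 with c1 | c1
    · rw [a1 c1, b1 c1]
    rcases lt_or_gt_of_ne n2 with c2 | c2
    · obtain ⟨τ, t0, t1, t2⟩ := a3 c1 c2
      obtain ⟨τ', t0', t1', t2'⟩ := b3 c1 c2
      rw [t2, t2', (G.strictMonoOn_fan U).injOn t0 t0' (t1.trans t1'.symm)]
    · rw [a2 c2, b2 c2]
  · exact absurd h1.P_le h1'.compressive.not_ge
  · exact absurd h1'.P_le h1.compressive.not_ge
  · have hm : m = m' := by
      have e : m ^ 2 * (U.τ - W.τ) = m' ^ 2 * (U.τ - W.τ) := h1.momentum.symm.trans h1'.momentum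
      exact (sq_eq_sq₀ h1.m_pos.le h1'.m_pos.le).1
        (mul_right_cancel₀ (sub_pos.2 h1.τ_lt).ne' e)
    subst hm
    refine ⟨Z ∪ Z' ∪ {U.u - m * U.τ}, fun ξ hξ hF => ?_⟩
    simp only [Finset.mem_union, Finset.mem_singleton, not_or] at hF
    obtain ⟨⟨hZ, hZ'⟩, n1⟩ := hF
    obtain ⟨a1, a2⟩ := h ξ hξ hZ
    obtain ⟨b1, b2⟩ := h' ξ hξ hZ'
    rcases lt_or_gt_of_ne n1 with c1 | c1
    · rw [a1 c1, b1 c1]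
    · rw [a2 c1, b2 c1]

namespace LeftHalf

variable {U : State} {V : ℝ → State} {Z : Finset ℝ} {M : ℝ → ℝ} {a : ℝ}

theorem u_eq_of_eq (h : G.LeftHalf U V Z M a) {W : State} {s : ℝ} (hs : s < a) (hW : 0 < W.ρ)
    (hV : ∀ ξ ∈ Ioo s a, ξ ∉ Z → V ξ = W) :
    W.u = a ∧ Converges V (𝓝[<] a) W := by
  have hev : ∀ᶠ ξ in 𝓝[<] a, ξ ∈ Ioo s a ∧ ξ ∉ Z :=
    Filter.Eventually.and (Ioo_mem_nhdsLT hs) (eventually_notMem_finset_left Z a)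
  refine ⟨?_, Converges.of_eventually_eq (by
    filter_upwards [hev] with ξ hξ using hV ξ hξ.1 hξ.2)⟩
  have h1 : Tendsto (fun ξ => W.ρ * (W.u - ξ)) (𝓝[<] a) (𝓝 (W.ρ * (W.u - a))) :=
    ((tendsto_id.mono_left nhdsWithin_le_nhds).const_sub _).const_mul _
  have h2 : M a = W.ρ * (W.u - a) := by
    refine tendsto_nhds_unique (h.cont.continuousAt.mono_left nhdsWithin_le_nhds) (h1.congr' ?_)
    filter_upwards [hev] with ξ hξ
    rw [h.flux ξ hξ.2, hV ξ hξ.1 hξ.2]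
  rw [h.zero] at h2
  have := (mul_eq_zero.1 h2.symm).resolve_left hW.ne'
  linarith

/-- The half line splits into a supersonic, a sonic and a subsonic part. -/
theorem exists_sonic_interval (h : G.LeftHalf U V Z M a) :
    ∃ s t, s ≤ t ∧ t ≤ a ∧ (∀ ξ < s, ξ ∉ Z → V ξ = U) ∧
      (∀ ξ ∈ Ioo s t, ξ ∉ Z → M ξ = G.C (V ξ)) ∧
      (t < a → ∃ W : State, 0 < W.ρ ∧ ∀ ξ ∈ Ioo t a, ξ ∉ Z → V ξ = W) := by
  -- Supersonic points precede subsonic ones, so s = sup B₁ and t = inf B₂ bound the sonic part.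
  -- Inserting a into B₂ covers the case without subsonic points.
  set B₁ := {ξ | ξ < a ∧ ξ ∉ Z ∧ G.C (V ξ) < M ξ}
  set B₂ := {ξ | ξ < a ∧ ξ ∉ Z ∧ M ξ < G.C (V ξ)}
  have hsub : ∀ η ∈ B₂, ∀ ξ ∈ Ioo η a, ξ ∉ Z → V ξ = V η := by
    intro η hη
    obtain ⟨L, R, pL, pR, cL, cR, mL, mR, hV, hj⟩ := h.limits hη.1
    obtain ⟨-, e⟩ := hV hη.2.1
    rw [e]
    exact h.eq_of_subsonic hη.1 pR cR (e ▸ hη.2.2)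
  have hlt : ∀ ξ ∈ B₁, ∀ η ∈ B₂, ξ ≤ η := by
    intro ξ hξ η hη
    by_contra hc
    push Not at hc
    have e := hsub η hη ξ ⟨hc, hξ.1⟩ hξ.2.1
    have h1 := hξ.2.2
    have h2 := hη.2.2
    have h3 := h.flux_lt hc hξ.1.le
    rw [e] at h1
    linarith
  have ne1 : B₁.Nonempty := h.exists_supersonic
  have bd1 : BddAbove B₁ := ⟨a, fun ξ hξ => hξ.1.le⟩
  have hle : ∀ ξ ∈ B₁, ∀ η ∈ insert a B₂, ξ ≤ η := by
    rintro ξ hξ η (rfl | hη)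
    exacts [hξ.1.le, hlt ξ hξ η hη]
  obtain ⟨ξ₁, hξ₁⟩ := ne1
  have bd2 : BddBelow (insert a B₂) := ⟨ξ₁, fun η hη => hle ξ₁ hξ₁ η hη⟩
  have ne2 : (insert a B₂).Nonempty := ⟨a, mem_insert a B₂⟩
  refine ⟨sSup B₁, sInf (insert a B₂), ?_, csInf_le bd2 (mem_insert a B₂), ?_, ?_, ?_⟩
  · exact csSup_le ⟨ξ₁, hξ₁⟩ fun ξ hξ => le_csInf ne2 fun η hη => hle ξ hξ η hη
  · intro ξ hξ hZ
    obtain ⟨η, hη, hlt'⟩ := exists_lt_of_lt_csSup ⟨ξ₁, hξ₁⟩ hξ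
    exact (h.eq_data_of_supersonic hη.1 hη.2.1 hη.2.2).2 ξ hlt' hZ
  · intro ξ hξ hZ
    have hξa : ξ < a := hξ.2.trans_le (csInf_le bd2 (mem_insert a B₂))
    rcases lt_trichotomy (M ξ) (G.C (V ξ)) with h1 | h1 | h1
    · exact absurd (csInf_le bd2 (mem_insert_of_mem a ⟨hξa, hZ, h1⟩)) hξ.2.not_ge
    · exact h1
    · exact absurd (le_csSup bd1 ⟨hξa, hZ, h1⟩) hξ.1.not_ge
  · intro hta
    have hex : ∀ ξ, sInf (insert a B₂) < ξ → ξ < a → ∃ η ∈ B₂, η < ξ := by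
      intro ξ h1 h2
      obtain ⟨η, hη, hlt'⟩ := exists_lt_of_csInf_lt ne2 h1
      rcases hη with rfl | hη
      · exact absurd hlt' h2.not_gt
      · exact ⟨η, hη, hlt'⟩
    obtain ⟨ξ₀, hξ₀, hZ₀⟩ := exists_notMem_finset Z hta
    refine ⟨V ξ₀, h.ρ_pos hξ₀.2 hZ₀, fun ξ hξ hZ => ?_⟩
    obtain ⟨η, hη, hlt'⟩ := hex (min ξ ξ₀) (lt_min hξ.1 hξ₀.1) (min_lt_of_left_lt hξ.2)
    rw [hsub η hη ξ ⟨hlt'.trans_le (min_le_left _ _), hξ.2⟩ hZ,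
      hsub η hη ξ₀ ⟨hlt'.trans_le (min_le_right _ _), hξ₀.2⟩ hZ₀]

/-- Sonic flow means u − x = Cτ, which is also the distance between u and the fan speed. -/
theorem fan_eq_of_sonic {W : State} {x m : ℝ} (hW : 0 < W.ρ) (hm : m = W.ρ * (W.u - x))
    (hC : m = G.C W) (hfan : W = G.fanState U W.τ) : G.fan U W.τ = x := by
  have h1 := G.fanState_u_sub_fan U W.τ
  rw [← hfan] at h1
  have h2 := State.ρ_mul_τ hW
  have h3 : W.S = U.S := (congrArg State.S hfan :)
  unfold C at hC
  rw [h3] at hC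
  have h4 : W.u - x = √(G.A U.S) * G.k W.τ * W.τ := by
    rw [← hC, hm]
    linear_combination (x - W.u) * h2
  linear_combination h4 - h1

theorem isBackwardWave_of_sonic (h : G.LeftHalf U V Z M a) {s t : ℝ} (hst : s < t) (hta : t ≤ a)
    (h1 : ∀ ξ < s, ξ ∉ Z → V ξ = U) (h2 : ∀ ξ ∈ Ioo s t, ξ ∉ Z → M ξ = G.C (V ξ))
    (h3 : t < a → ∃ W : State, 0 < W.ρ ∧ ∀ ξ ∈ Ioo t a, ξ ∉ Z → V ξ = W) :
    ∃ W, G.IsBackwardWave U W V Z a ∧ W.u = a ∧ Converges V (𝓝[<] a) W := by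
  have hsa := hst.trans_le hta
  have evr : ∀ᶠ ξ in 𝓝[>] s, ξ ∈ Ioo s t ∧ ξ ∉ Z :=
    Filter.Eventually.and (Ioo_mem_nhdsGT hst) (eventually_notMem_finset_right Z s)
  have evl : ∀ᶠ ξ in 𝓝[<] t, ξ ∈ Ioo s t ∧ ξ ∉ Z :=
    Filter.Eventually.and (Ioo_mem_nhdsLT hst) (eventually_notMem_finset_left Z t)
  obtain ⟨L, R, pL, pR, cL, cR, mL, mR, -, hj⟩ := h.limits hsa
  have eL : L = U := cL.unique (Converges.of_eventually_eq (by
    filter_upwards [self_mem_nhdsWithin, eventually_notMem_finset_left Z s] with ξ a1 a2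
      using h1 ξ a1 a2))
  have sR : M s = G.C R := tendsto_nhds_unique
    (h.cont.continuousAt.mono_left nhdsWithin_le_nhds) ((cR.sound pR).congr' (by
      filter_upwards [evr] with ξ hξ using (h2 ξ hξ.1 hξ.2).symm))
  -- The limit behind s is sonic, whereas behind a shock the flow is strictly subsonic.
  have eR : R = U := by
    rcases hj with e | hsh
    · rw [e, eL]
    · exact absurd sR hsh.lax.2.ne
  rw [eR] at cR sR mR
  have hfs : G.fan U U.τ = s := fan_eq_of_sonic h.data_pos mR sR (G.fanState_self U).symm
  have hfan := h.eq_fanState_of_sonic hta hsa cR h2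
  have hfx : ∀ ξ ∈ Ioo s t, ξ ∉ Z → G.fan U (V ξ).τ = ξ := fun ξ hξ hZ =>
    fan_eq_of_sonic (h.ρ_pos (hξ.2.trans_le hta) hZ) (h.flux ξ hZ) (h2 ξ hξ hZ) (hfan ξ hξ hZ)
  rcases hta.eq_or_lt with rfl | hta'
  -- A fan lasting up to the ray a is impossible: choosing B with fan speed at least a keeps τ < B,
  -- so M = C stays above the positive constant √A k(B), against M a = 0.
  · exfalso
    obtain ⟨B, hB, hB0⟩ := (((G.tendsto_fan_atTop U).eventually_ge_atTop t).and
      (eventually_gt_atTop 0)).exists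
    have hpos : 0 < √(G.A U.S) * G.k B := mul_pos (G.sqrtA_pos _) (G.k_pos B hB0)
    have hle : √(G.A U.S) * G.k B ≤ M t := by
      refine ge_of_tendsto (h.cont.continuousAt.mono_left (nhdsWithin_le_nhds (s := Iio t))) ?_
      filter_upwards [evl] with ξ hξ
      have hτ := State.τ_pos (h.ρ_pos hξ.1.2 hξ.2)
      have hτB : (V ξ).τ < B := ((G.strictMonoOn_fan U).lt_iff_lt hτ hB0).1
        ((hfx ξ hξ.1 hξ.2).trans_lt (hξ.1.2.trans_le hB))
      have hS : (V ξ).S = U.S := (congrArg State.S (hfan ξ hξ.1 hξ.2) :)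
      rw [h2 ξ hξ.1 hξ.2]
      unfold C
      rw [hS]
      exact mul_le_mul_of_nonneg_left (G.strictAntiOn_k hτ hB0 hτB).le (G.sqrtA_pos _).le
    rw [h.zero] at hle
    exact hpos.not_ge hle
  · obtain ⟨W, hW, hVW⟩ := h3 hta'
    obtain ⟨hu, hconv⟩ := h.u_eq_of_eq hta' hW hVW
    obtain ⟨L', R', pL', pR', cL', cR', mL', mR', -, hj'⟩ := h.limits hta'
    have sL : M t = G.C L' := tendsto_nhds_unique
      (h.cont.continuousAt.mono_left nhdsWithin_le_nhds) ((cL'.sound pL').congr' (by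
        filter_upwards [evl] with ξ hξ using (h2 ξ hξ.1 hξ.2).symm))
    have eRL : R' = L' := by
      rcases hj' with e | hsh
      · exact e
      · exact absurd sL hsh.lax.1.ne'
    have eRW : R' = W := cR'.unique (Converges.of_eventually_eq (by
      filter_upwards [Ioo_mem_nhdsGT hta', eventually_notMem_finset_right Z t] with ξ a1 a2
        using hVW ξ a1 a2))
    rw [← eRL, eRW] at cL' sL mL'
    have hWS : W.S = U.S := tendsto_nhds_unique cL'.S (tendsto_const_nhds.congr' (by
      filter_upwards [evl] with ξ hξ using (congrArg State.S (hfan ξ hξ.1 hξ.2)).symm))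
    have hWu : W.u = U.u + √(G.A U.S) * (G.Φ W.τ - G.Φ U.τ) := by
      refine tendsto_nhds_unique cL'.u (Tendsto.congr' ?_
        (((Tendsto.comp (G.hasDerivAt_Φ _ (State.τ_pos hW)).continuousAt
          (cL'.τ hW)).sub_const (G.Φ U.τ)).const_mul (√(G.A U.S)) |>.const_add U.u))
      filter_upwards [evl] with ξ hξ using (congrArg State.u (hfan ξ hξ.1 hξ.2)).symm
    have hWfan : W = G.fanState U W.τ := State.ext_τ (by rw [fanState_τ]) hWu hWS
    have hft : G.fan U W.τ = t := fan_eq_of_sonic hW mL' sL hWfan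
    refine ⟨W, Or.inl ⟨⟨h.data_pos, hW, hWS, ?_, hWu⟩, fun ξ hξ hZ => ?_⟩, hu, hconv⟩
    · refine ((G.strictMonoOn_fan U).le_iff_le (State.τ_pos h.data_pos) (State.τ_pos hW)).1 ?_
      rw [hfs, hft]; exact hst.le
    · rw [hfs, hft]
      exact ⟨fun c => h1 ξ c hZ, fun c => hVW ξ ⟨c, hξ⟩ hZ, fun c1 c2 =>
        ⟨(V ξ).τ, State.τ_pos (h.ρ_pos hξ hZ), hfx ξ ⟨c1, c2⟩ hZ, hfan ξ ⟨c1, c2⟩ hZ⟩⟩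

/-- The profile on the half line is a single backward wave. -/
theorem exists_isBackwardWave (h : G.LeftHalf U V Z M a) :
    ∃ W, G.IsBackwardWave U W V Z a ∧ W.u = a ∧ Converges V (𝓝[<] a) W := by
  obtain ⟨s, t, hst, hta, h1, h2, h3⟩ := h.exists_sonic_interval
  rcases hst.lt_or_eq with hlt | rfl
  · exact h.isBackwardWave_of_sonic hlt hta h1 h2 h3
  -- With no sonic interval, the profile is either constant up to a or has a single possible jump at
  -- s.
  rcases hta.eq_or_lt with rfl | hsa
  · obtain ⟨hu, hc⟩ := h.u_eq_of_eq (sub_one_lt s) h.data_pos fun ξ hξ hZ => h1 ξ hξ.2 hZ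
    exact ⟨U, isBackwardWave_self h.data_pos h1, hu, hc⟩
  obtain ⟨W, hW, hVW⟩ := h3 hsa
  obtain ⟨hu, hc⟩ := h.u_eq_of_eq hsa hW hVW
  obtain ⟨L, R, pL, pR, cL, cR, mL, mR, hV, hj⟩ := h.limits hsa
  have eL : L = U := cL.unique (Converges.of_eventually_eq (by
    filter_upwards [self_mem_nhdsWithin, eventually_notMem_finset_left Z s] with ξ a1 a2
      using h1 ξ a1 a2))
  have eR : R = W := cR.unique (Converges.of_eventually_eq (by
    filter_upwards [Ioo_mem_nhdsGT hsa, eventually_notMem_finset_right Z s] with ξ a1 a2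
      using hVW ξ a1 a2))
  rw [eL, eR] at hj
  rw [eL] at mL
  have hs : U.u - M s * U.τ = s := by
    have := State.ρ_mul_τ h.data_pos
    rw [mL]
    linear_combination (s - U.u) * this
  refine ⟨W, ?_, hu, hc⟩
  rcases hj with rfl | hsh
  · refine isBackwardWave_self h.data_pos fun ξ hξ hZ => ?_
    rcases lt_trichotomy ξ s with c | rfl | c
    · exact h1 ξ c hZ
    · exact ((hV hZ).1.trans eL)
    · exact hVW ξ ⟨c, hξ⟩ hZ
  · refine Or.inr ⟨M s, hsh, fun ξ hξ hZ => ?_⟩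
    rw [hs]
    exact ⟨fun c => h1 ξ c hZ, fun c => hVW ξ ⟨c, hξ⟩ hZ⟩

end LeftHalf

/-! ### Global structure and uniqueness -/

theorem exists_flux_pos {U : State} {V : ℝ → State} (hU : 0 < U.ρ) (h : TendsToState V atBot U)
    (Z : Finset ℝ) : ∃ ξ ∉ Z, 0 < (V ξ).ρ * ((V ξ).u - ξ) := by
  have h1 := (h.converges hU.ne').tendsto_flux_atBot hU
  exact ((eventually_notMem_finset_atBot Z).and (h1.eventually_gt_atTop 0)).exists

/-- Every solution consists of a backward wave, a contact discontinuity and a forward wave. -/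
theorem exists_waves {UL UR : State} {V : ℝ → State} (hL : 0 < UL.ρ) (hR : 0 < UR.ρ)
    (h : IsRiemannSolution G.E UL UR V) :
    ∃ (a : ℝ) (W W' : State) (Z Z' : Finset ℝ), G.IsBackwardWave UL W V Z a ∧
      G.IsBackwardWave UR.refl W' (reflProfile V) Z' (-a) ∧ G.P W = G.P W' ∧ W.u = a ∧
      W'.u = -a := by
  obtain ⟨Z, hS, hJZ⟩ := h.piecewise
  have hS : ∀ ξ, ξ ∉ Z → SmoothAt G.E V ξ := hS
  have hJ : ∀ s, JumpAt G.E V s := fun s => by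
    by_cases hs : s ∈ Z
    exacts [hJZ s hs, (hS s hs).jumpAt]
  obtain ⟨M, hMc, hMV, hMd, hanti⟩ := exists_massFlux h.nonneg hS hJ
  have hr := h.reflect
  obtain ⟨ξ₁, hξ₁, hp₁⟩ := exists_flux_pos hL h.left_data Z
  rw [← hMV ξ₁ hξ₁] at hp₁
  obtain ⟨ξ₂, hξ₂, hp₂⟩ := exists_flux_pos (U := UR.refl) hR hr.left_data (Z.image Neg.neg)
  have hξ₂' : -ξ₂ ∉ Z := fun hm => hξ₂ (Finset.mem_image.2 ⟨-ξ₂, hm, neg_neg _⟩)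
  have hn₂ : M (-ξ₂) < 0 := by
    rw [hMV _ hξ₂']
    simp only [reflProfile, State.refl] at hp₂
    linarith
  -- At this stage vacuum to the right of a, where M would vanish on an interval, is not yet
  -- excluded.
  set a := sSup {ξ | 0 < M ξ} with ha
  have hbd : BddAbove {ξ | 0 < M ξ} := ⟨-ξ₂, fun ξ hξ => by
    by_contra hc
    push Not at hc
    exact (hn₂.trans hξ).not_ge (hanti hc.le)⟩
  have hne : {ξ | 0 < M ξ}.Nonempty := ⟨ξ₁, hp₁⟩
  have hpos : ∀ ξ < a, 0 < M ξ := fun ξ hξ => by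
    obtain ⟨η, hη, hlt⟩ := exists_lt_of_lt_csSup hne hξ
    exact lt_of_lt_of_le hη (hanti hlt.le)
  have hnonpos : ∀ ξ, a < ξ → M ξ ≤ 0 := fun ξ hξ => by
    by_contra hc
    push Not at hc
    exact (le_csSup hbd hc).not_gt hξ
  have hzero : M a = 0 := by
    refine le_antisymm ?_ ?_
    · refine le_of_tendsto (hMc.continuousAt.mono_left (nhdsWithin_le_nhds (s := Ioi a))) ?_
      filter_upwards [self_mem_nhdsWithin] with ξ hξ using hnonpos ξ hξ
    · refine ge_of_tendsto (hMc.continuousAt.mono_left (nhdsWithin_le_nhds (s := Iio a))) ?_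
      filter_upwards [self_mem_nhdsWithin] with ξ hξ using (hpos ξ hξ).le
  obtain ⟨W, hW, hWu, hWc⟩ := LeftHalf.exists_isBackwardWave (G := G)
    ⟨h.nonneg, hL, h.left_data, hS, hJ, hMc, hMV, hMd, hpos, hzero⟩
  have hWpos := hW.onWaveCurve.behind
  obtain ⟨L, R, tL, tR, hRH, -⟩ := hJ a
  have eLρ : L.ρ = W.ρ := tendsto_nhds_unique tL.1 hWc.ρ
  have eL : L = W := (tL.converges (by rw [eLρ]; exact hWpos.ne')).unique hWc
  subst eL
  -- No gas crosses the ray a, so the momentum law reduces to equality of pressures, and a positive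
  -- pressure rules out vacuum on the right.
  have hRp : R.p G.E = G.P L := by
    have e0 := hRH 0
    have e1 := hRH 1
    simp only [density, flux, Matrix.cons_val_zero, Matrix.cons_val_one] at e0 e1
    rw [G.p_eq hWpos] at e1
    rw [hWu] at e0 e1
    have e2 : R.ρ * (R.u - a) = 0 := by linarith
    linear_combination -e1 - R.u * e2
  have hRne : R.ρ ≠ 0 := fun h0 => by
    have : R.p G.E = 0 := by simp [State.p, h0]
    rw [this] at hRp
    exact (G.P_pos hWpos).ne hRp
  have hRpos : 0 < R.ρ := lt_of_le_of_ne (ge_of_tendsto' tR.1 fun ξ => h.nonneg ξ) hRne.symm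
  obtain ⟨b, hb, hsub⟩ := mem_nhdsGT_iff_exists_Ioo_subset.1
    (tR.1.eventually (lt_mem_nhds hRpos))
  -- Positive density just to the right of a makes M drop strictly there; monotonicity keeps it
  -- negative.
  have hneg : ∀ ξ, a < ξ → M ξ < 0 := fun ξ hξ => by
    obtain ⟨η, h1, h2⟩ := exists_between (lt_min hξ hb)
    have h3 : M η < M a := lt_of_hasDerivAt_neg_off_finset hMc Z h1 fun z hz hZ =>
      ⟨hMd z hZ, neg_neg_of_pos (hsub ⟨hz.1, hz.2.trans (h2.trans_le (min_le_right _ _))⟩)⟩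
    exact (hanti (h2.trans_le (min_le_left _ _)).le).trans_lt (h3.trans_eq hzero)
  have hZr : ∀ ξ, ξ ∉ Z.image Neg.neg → -ξ ∉ Z := fun ξ hξ hm =>
    hξ (Finset.mem_image.2 ⟨-ξ, hm, neg_neg _⟩)
  obtain ⟨W', hW', hWu', hWc'⟩ := LeftHalf.exists_isBackwardWave (G := G) (U := UR.refl)
    (V := reflProfile V) (Z := Z.image Neg.neg) (M := fun ξ => -M (-ξ)) (a := -a)
    ⟨hr.nonneg, hR, hr.left_data, fun ξ hξ => SmoothAt.reflect (hS _ (hZr ξ hξ)),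
      fun s => JumpAt.reflect (hJ _), (hMc.comp continuous_neg).neg, fun ξ hξ => by
        rw [hMV _ (hZr ξ hξ)]
        simp only [reflProfile, State.refl]
        ring,
      fun ξ hξ => by
        have h1 := hMd _ (hZr ξ hξ)
        have h2 := (HasDerivAt.comp (h := fun ξ : ℝ => -ξ) ξ h1 (hasDerivAt_neg ξ)).neg
        refine h2.congr_deriv ?_
        simp [reflProfile, State.refl],
      fun ξ hξ => neg_pos.2 (hneg _ (by linarith)), by simp [hzero]⟩
  have eR : R.refl = W' := by
    have h1 : TendsToState (reflProfile V) (𝓝[<] (-a)) R.refl := tR.reflect (by simp)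
    exact (h1.converges hRne).unique hWc'
  refine ⟨a, L, W', Z, Z.image Neg.neg, hW, hW', ?_, hWu, hWu'⟩
  rw [← eR, P_refl, ← hRp, G.p_eq hRpos]

/-- Both solutions yield crossings of the same two wave curves, so their middle states and contact
speeds coincide, and with them the two waves. -/
theorem isRiemannSolution_unique {UL UR : State} {V V' : ℝ → State} (hL : 0 < UL.ρ)
    (hR : 0 < UR.ρ) (h : IsRiemannSolution G.E UL UR V) (h' : IsRiemannSolution G.E UL UR V') :
    {ξ : ℝ | V' ξ ≠ V ξ}.Finite := by
  obtain ⟨a, W, X, Z, Y, hW, hX, hP, hWa, hXa⟩ := exists_waves hL hR h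
  obtain ⟨a', W', X', Z', Y', hW', hX', hP', hWa', hXa'⟩ := exists_waves hL hR h'
  obtain ⟨e1, e2⟩ := intersection_unique hW.onWaveCurve hX.onWaveCurve hP (by linarith)
    hW'.onWaveCurve hX'.onWaveCurve hP' (by linarith)
  subst e1 e2
  obtain rfl : a = a' := hWa.symm.trans hWa'
  obtain ⟨F, hF⟩ := hW.exists_finset_eq hW'
  obtain ⟨F', hF'⟩ := hX.exists_finset_eq hX'
  refine (F ∪ F'.image Neg.neg ∪ {a}).finite_toSet.subset fun ξ hξ => ?_
  by_contra hc
  simp only [Finset.mem_coe, Finset.mem_union, Finset.mem_singleton, Finset.mem_image,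
    not_or] at hc
  obtain ⟨⟨c1, c2⟩, c3⟩ := hc
  refine hξ ?_
  rcases lt_or_gt_of_ne c3 with hlt | hgt
  · exact (hF ξ hlt c1).symm
  · have e := hF' (-ξ) (by linarith) fun hm => c2 ⟨-ξ, hm, neg_neg ξ⟩
    have e' := congrArg State.refl e
    simp only [reflProfile, neg_neg, State.refl_refl] at e'
    exact e'.symm

/-- The Riemann problem has a solution without vacuum, and it is unique. -/
theorem riemann_problem {UL UR : State} (hL : 0 < UL.ρ) (hR : 0 < UR.ρ) :
    ∃ V : ℝ → State, IsRiemannSolution G.E UL UR V ∧ (∃ δ : ℝ, 0 < δ ∧ ∀ ξ : ℝ, δ ≤ (V ξ).ρ) ∧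
      ∀ V' : ℝ → State, IsRiemannSolution G.E UL UR V' → {ξ : ℝ | V' ξ ≠ V ξ}.Finite := by
  obtain ⟨V, hV, hδ⟩ := exists_isRiemannSolution (G := G) hL hR
  exact ⟨V, hV, hδ, fun V' hV' => isRiemannSolution_unique hL hR hV hV'⟩

end GasLaw

/-! ### The logarithmic equation of state -/

namespace LogLaw

theorem log_pos {τ : ℝ} (hτ : 0 < τ) : 0 < Real.log (τ + 1) := Real.log_pos (by linarith)

theorem hasDerivAt_log_add_one {τ : ℝ} (hτ : 0 < τ) :
    HasDerivAt (fun τ => Real.log (τ + 1)) (1 / (τ + 1)) τ :=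
  ((hasDerivAt_id τ).add_const 1).log (by simp only [id]; linarith)

theorem hasDerivAt_log_rpow (r : ℝ) {τ : ℝ} (hτ : 0 < τ) :
    HasDerivAt (fun τ => Real.log (τ + 1) ^ r) (r * Real.log (τ + 1) ^ (r - 1) / (τ + 1)) τ := by
  refine ((hasDerivAt_log_add_one hτ).rpow_const (Or.inl (log_pos hτ).ne')).congr_deriv ?_
  ring

/-- The square of the sound speed factor, `-g'`. -/
noncomputable def q (σ τ : ℝ) : ℝ :=
  (2 * σ * Real.log (τ + 1) ^ (-2 * σ - 1) + Real.log (τ + 1) ^ (-2 * σ)) / (τ + 1) ^ 2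

/-- The derivative of `q`. -/
noncomputable def dq (σ τ : ℝ) : ℝ :=
  -(2 * σ * (2 * σ + 1) * Real.log (τ + 1) ^ (-2 * σ - 1 - 1) +
    2 * σ * Real.log (τ + 1) ^ (-2 * σ - 1) +
    2 * (2 * σ * Real.log (τ + 1) ^ (-2 * σ - 1) + Real.log (τ + 1) ^ (-2 * σ))) / (τ + 1) ^ 3

theorem q_pos {σ τ : ℝ} (hσ : 0 < σ) (hτ : 0 < τ) : 0 < q σ τ := by
  have h := log_pos hτ
  have h1 := Real.rpow_pos_of_pos h (-2 * σ - 1)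
  have h2 := Real.rpow_pos_of_pos h (-2 * σ)
  unfold q
  positivity

theorem dq_neg {σ τ : ℝ} (hσ : 0 < σ) (hτ : 0 < τ) : dq σ τ < 0 := by
  have h := log_pos hτ
  have h1 := Real.rpow_pos_of_pos h (-2 * σ - 1)
  have h2 := Real.rpow_pos_of_pos h (-2 * σ)
  have h3 := Real.rpow_pos_of_pos h (-2 * σ - 1 - 1)
  unfold dq
  exact div_neg_of_neg_of_pos (neg_neg_of_pos (by positivity)) (by positivity)

theorem hasDerivAt_q (σ : ℝ) {τ : ℝ} (hτ : 0 < τ) : HasDerivAt (q σ) (dq σ τ) τ := by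
  have h0 : τ + 1 ≠ 0 := by positivity
  have h1 := ((hasDerivAt_log_rpow (-2 * σ - 1) hτ).const_mul (2 * σ)).add
    (hasDerivAt_log_rpow (-2 * σ) hτ)
  have h2 := ((hasDerivAt_id τ).add_const 1).pow 2
  refine (h1.div h2 (by simpa using h0)).congr_deriv ?_
  unfold dq
  simp only [Pi.add_apply, Pi.pow_apply, id]
  push_cast
  field_simp
  ring

theorem hasDerivAt_h {σ τ : ℝ} (hσ : 1 / 2 < σ) (hτ : 0 < τ) :
    HasDerivAt (fun τ => Real.log (τ + 1) ^ (1 - 2 * σ) / (2 * σ - 1))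
      (-(Real.log (τ + 1) ^ (-2 * σ) / (τ + 1))) τ := by
  have h0 : 2 * σ - 1 ≠ 0 := by linarith
  refine ((hasDerivAt_log_rpow (1 - 2 * σ) hτ).div_const (2 * σ - 1)).congr_deriv ?_
  rw [show 1 - 2 * σ - 1 = -2 * σ by ring]
  field_simp
  ring

theorem hasDerivAt_g (σ : ℝ) {τ : ℝ} (hτ : 0 < τ) :
    HasDerivAt (fun τ => Real.log (τ + 1) ^ (-2 * σ) / (τ + 1)) (-q σ τ) τ := by
  have h0 : τ + 1 ≠ 0 := by positivity
  refine ((hasDerivAt_log_rpow (-2 * σ) hτ).div ((hasDerivAt_id τ).add_const 1) h0).congr_deriv ?_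
  unfold q
  simp only [id]
  field_simp
  ring

theorem hasDerivAt_k {σ τ : ℝ} (hσ : 0 < σ) (hτ : 0 < τ) :
    HasDerivAt (fun τ => √(q σ τ)) (dq σ τ / (2 * √(q σ τ))) τ :=
  (hasDerivAt_q σ hτ).sqrt (q_pos hσ hτ).ne'

theorem continuousOn_log_rpow (r : ℝ) :
    ContinuousOn (fun τ => Real.log (τ + 1) ^ r) (Ioi 0) := fun _ hτ =>
  (hasDerivAt_log_rpow r hτ).continuousAt.continuousWithinAt

theorem continuousOn_dq (σ : ℝ) : ContinuousOn (dq σ) (Ioi 0) := by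
  have h1 := continuousOn_log_rpow (-2 * σ - 1 - 1)
  have h2 := continuousOn_log_rpow (-2 * σ - 1)
  have h3 := continuousOn_log_rpow (-2 * σ)
  refine ContinuousOn.div (by fun_prop) (by fun_prop) fun τ hτ => ?_
  have : (0 : ℝ) < τ := hτ
  positivity

theorem continuousOn_k {σ : ℝ} (hσ : 0 < σ) : ContinuousOn (fun τ => √(q σ τ)) (Ioi 0) :=
  fun _ hτ => (hasDerivAt_k hσ hτ).continuousAt.continuousWithinAt

theorem hasDerivAt_Φ {σ τ : ℝ} (hσ : 0 < σ) (hτ : 0 < τ) :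
    HasDerivAt (fun τ => ∫ t in (1 : ℝ)..τ, √(q σ t)) (√(q σ τ)) τ := by
  have hc := continuousOn_k hσ
  have hsub : uIcc 1 τ ⊆ Ioi (0 : ℝ) := by
    intro x hx
    exact (lt_min one_pos hτ).trans_le hx.1
  exact intervalIntegral.integral_hasDerivAt_right (hc.mono hsub).intervalIntegrable
    (hc.stronglyMeasurableAtFilter isOpen_Ioi τ hτ) (hc.continuousAt (Ioi_mem_nhds hτ))

theorem tendsto_log_add_one : Tendsto (fun τ : ℝ => Real.log (τ + 1)) atTop atTop :=
  Real.tendsto_log_atTop.comp (tendsto_atTop_add_const_right _ 1 tendsto_id)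

theorem tendsto_g {σ : ℝ} (hσ : 0 < σ) :
    Tendsto (fun τ => Real.log (τ + 1) ^ (-2 * σ) / (τ + 1)) atTop (𝓝 0) := by
  have h1 : Tendsto (fun τ : ℝ => Real.log (τ + 1) ^ (-(2 * σ))) atTop (𝓝 0) :=
    (tendsto_rpow_neg_atTop (by linarith : 0 < 2 * σ)).comp tendsto_log_add_one
  have h2 : Tendsto (fun τ : ℝ => (τ + 1)⁻¹) atTop (𝓝 0) :=
    tendsto_inv_atTop_zero.comp (tendsto_atTop_add_const_right _ 1 tendsto_id)
  simpa [div_eq_mul_inv, neg_mul] using h1.mul h2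

theorem one_le_log {τ : ℝ} (hτ : Real.exp 1 ≤ τ) : 1 ≤ Real.log (τ + 1) := by
  rw [Real.le_log_iff_exp_le (by linarith [Real.exp_pos 1])]
  linarith

/-- For τ ≥ e one has ln(τ+1) ≥ 1, so q ≤ (2σ+1)/(τ+1)² ≤ 4/(τ+1)². -/
theorem mul_k_le {σ τ : ℝ} (hσ : 0 < σ) (hσ' : σ ≤ 1) (hτ : Real.exp 1 ≤ τ) :
    τ * √(q σ τ) ≤ 2 := by
  have h0 : 0 < τ := (Real.exp_pos 1).trans_le hτ
  have h1 := one_le_log hτ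
  have a1 : Real.log (τ + 1) ^ (-2 * σ - 1) ≤ 1 :=
    Real.rpow_le_one_of_one_le_of_nonpos h1 (by linarith)
  have a2 : Real.log (τ + 1) ^ (-2 * σ) ≤ 1 :=
    Real.rpow_le_one_of_one_le_of_nonpos h1 (by linarith)
  have h2 : √(q σ τ) ≤ 2 / (τ + 1) := by
    refine Real.sqrt_le_iff.2 ⟨by positivity, ?_⟩
    unfold q
    rw [div_pow]
    refine div_le_div_of_nonneg_right ?_ (by positivity)
    have a3 : 2 * σ * Real.log (τ + 1) ^ (-2 * σ - 1) ≤ 2 * σ * 1 :=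
      mul_le_mul_of_nonneg_left a1 (by linarith)
    linarith
  calc τ * √(q σ τ) ≤ τ * (2 / (τ + 1)) := mul_le_mul_of_nonneg_left h2 h0.le
    _ ≤ 2 := by
      rw [mul_div_assoc', div_le_iff₀ (by linarith)]
      linarith

/-- Here σ ≤ 1 is decisive: ln(τ+1)^(−2σ) ≥ ln(τ+1)^(−2). The lower bound is the derivative of ln
ln(τ+1), which is unbounded. -/
theorem le_k {σ τ : ℝ} (hσ : 0 < σ) (hσ' : σ ≤ 1) (hτ : Real.exp 1 ≤ τ) :
    1 / (τ + 1) / Real.log (τ + 1) ≤ √(q σ τ) := by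
  have h0 : 0 < τ := (Real.exp_pos 1).trans_le hτ
  have h1 := one_le_log hτ
  have hL := log_pos h0
  refine Real.le_sqrt_of_sq_le ?_
  have a1 : Real.log (τ + 1) ^ (-2 : ℝ) ≤ Real.log (τ + 1) ^ (-2 * σ) :=
    Real.rpow_le_rpow_of_exponent_le h1 (by linarith)
  have a2 : Real.log (τ + 1) ^ (-2 : ℝ) = (Real.log (τ + 1) ^ 2)⁻¹ := by
    rw [Real.rpow_neg hL.le, Real.rpow_two]
  have a3 := Real.rpow_pos_of_pos hL (-2 * σ - 1)
  unfold q
  rw [div_div, div_pow, one_pow, mul_pow, ← div_div, div_right_comm, one_div, ← a2]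
  refine div_le_div_of_nonneg_right ?_ (by positivity)
  have : 0 < 2 * σ * Real.log (τ + 1) ^ (-2 * σ - 1) := by positivity
  linarith

theorem tendsto_fan {σ : ℝ} (hσ : 0 < σ) (hσ' : σ ≤ 1) :
    Tendsto (fun τ => (∫ t in (1 : ℝ)..τ, √(q σ t)) - τ * √(q σ τ)) atTop atTop := by
  set F : ℝ → ℝ := fun τ => (∫ t in (1 : ℝ)..τ, √(q σ t)) - Real.log (Real.log (τ + 1)) with hF
  have hFd : ∀ τ, Real.exp 1 ≤ τ →
      HasDerivAt F (√(q σ τ) - 1 / (τ + 1) / Real.log (τ + 1)) τ := fun τ hτ => by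
    have h0 : 0 < τ := (Real.exp_pos 1).trans_le hτ
    exact (hasDerivAt_Φ hσ h0).sub ((hasDerivAt_log_add_one h0).log (log_pos h0).ne')
  have hmono : MonotoneOn F (Ici (Real.exp 1)) := by
    refine monotoneOn_of_deriv_nonneg (convex_Ici _)
      (fun τ hτ => (hFd τ hτ).continuousAt.continuousWithinAt) (fun τ hτ => ?_) fun τ hτ => ?_
    all_goals
      rw [interior_Ici] at hτ
      have hd := hFd τ (le_of_lt hτ)
    · exact hd.differentiableAt.differentiableWithinAt
    · rw [hd.deriv]
      exact sub_nonneg.2 (le_k hσ hσ' (le_of_lt hτ))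
  -- Since F is nondecreasing on [e, ∞) and τk ≤ 2 there, the function is at least F(e) − 2 + ln
  -- ln(τ+1).
  refine tendsto_atTop_mono' _ ?_ (tendsto_atTop_add_const_left _ (F (Real.exp 1) - 2)
    (Real.tendsto_log_atTop.comp tendsto_log_add_one))
  filter_upwards [eventually_ge_atTop (Real.exp 1)] with τ hτ
  have h1 := hmono self_mem_Ici hτ hτ
  have h2 := mul_k_le hσ hσ' hτ
  simp only [hF, Function.comp] at h1 ⊢
  linarith

theorem ratio_q {σ τ : ℝ} (hτ : 0 < τ) :
    q σ τ / (Real.log (τ + 1) ^ (-2 * σ) / (τ + 1)) =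
      (2 * σ / Real.log (τ + 1) + 1) / (τ + 1) := by
  have hL := log_pos hτ
  have h2 := Real.rpow_pos_of_pos hL (-2 * σ)
  unfold q
  rw [Real.rpow_sub_one hL.ne']
  field_simp

theorem ratio_h {σ τ : ℝ} (hσ : 1 / 2 < σ) (hτ : 0 < τ) :
    Real.log (τ + 1) ^ (1 - 2 * σ) / (2 * σ - 1) / (Real.log (τ + 1) ^ (-2 * σ) / (τ + 1)) =
      Real.log (τ + 1) * (τ + 1) / (2 * σ - 1) := by
  have hL := log_pos hτ
  have h2 := Real.rpow_pos_of_pos hL (-2 * σ)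
  have h3 : 2 * σ - 1 ≠ 0 := by linarith
  rw [show 1 - 2 * σ = -2 * σ + 1 by ring, Real.rpow_add_one hL.ne']
  field_simp

end LogLaw

open LogLaw in
/-- The gas law with `E = K₀ e^{S/c} (ln(τ+1))^{1-2σ} / (2σ-1)`. -/
noncomputable def logLaw {K₀ c σ : ℝ} (hK₀ : 0 < K₀) (hc : 0 < c) (hσ : 1 / 2 < σ) (hσ' : σ ≤ 1) :
    GasLaw where
  A S := K₀ * Real.exp (S / c)
  dA S := K₀ * (Real.exp (S / c) * (1 / c))
  h τ := Real.log (τ + 1) ^ (1 - 2 * σ) / (2 * σ - 1)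
  g τ := Real.log (τ + 1) ^ (-2 * σ) / (τ + 1)
  k τ := √(q σ τ)
  dk τ := dq σ τ / (2 * √(q σ τ))
  -- The base point is an arbitrary positive number; 0 would not do, since k is not integrable
  -- there.
  Φ τ := ∫ t in (1 : ℝ)..τ, √(q σ t)
  A_pos S := by positivity
  dA_pos S := by positivity
  A_surj y hy := ⟨c * Real.log (y / K₀), by
    rw [mul_div_cancel_left₀ _ hc.ne', Real.exp_log (by positivity)]
    field_simp⟩
  hasDerivAt_A S := (((hasDerivAt_id S).div_const c).exp).const_mul K₀
  h_pos τ hτ := div_pos (Real.rpow_pos_of_pos (log_pos hτ) _) (by linarith)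
  g_pos τ hτ := div_pos (Real.rpow_pos_of_pos (log_pos hτ) _) (by linarith)
  k_pos τ hτ := Real.sqrt_pos.2 (q_pos (by linarith) hτ)
  dk_neg τ hτ := div_neg_of_neg_of_pos (dq_neg (by linarith) hτ)
    (mul_pos two_pos (Real.sqrt_pos.2 (q_pos (by linarith) hτ)))
  hasDerivAt_h τ hτ := hasDerivAt_h hσ hτ
  hasDerivAt_g τ hτ := by
    rw [Real.sq_sqrt (q_pos (by linarith) hτ).le]
    exact hasDerivAt_g σ hτ
  hasDerivAt_k τ hτ := hasDerivAt_k (by linarith) hτ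
  hasDerivAt_Φ τ hτ := hasDerivAt_Φ (by linarith) hτ
  continuousOn_dk := (continuousOn_dq σ).div (continuousOn_const.mul (continuousOn_k (by linarith)))
    fun τ hτ => (mul_pos two_pos (Real.sqrt_pos.2 (q_pos (by linarith) hτ))).ne'
  tendsto_g := tendsto_g (by linarith)
  tendsto_fan := tendsto_fan (by linarith) hσ'
  strictAntiOn_ratio := by
    intro x hx y hy hxy
    have hx : 0 < x := hx
    have hy : 0 < y := hy
    simp only
    rw [Real.sq_sqrt (q_pos (by linarith) hx).le, Real.sq_sqrt (q_pos (by linarith) hy).le,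
      ratio_q hx, ratio_q hy]
    have hLx := log_pos hx
    have hL : Real.log (x + 1) < Real.log (y + 1) := Real.log_lt_log (by linarith) (by linarith)
    have h1 : 2 * σ / Real.log (y + 1) < 2 * σ / Real.log (x + 1) :=
      div_lt_div_of_pos_left (by linarith) hLx hL
    have h2 : 0 < 2 * σ / Real.log (x + 1) := div_pos (by linarith) hLx
    exact div_lt_div₀ (by linarith) (by linarith) (by linarith) (by linarith)
  strictMonoOn_ratio := by
    intro x hx y hy hxy
    have hx : 0 < x := hx
    have hy : 0 < y := hy
    simp only
    rw [ratio_h hσ hx, ratio_h hσ hy]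
    have hL : Real.log (x + 1) < Real.log (y + 1) := Real.log_lt_log (by linarith) (by linarith)
    have := mul_lt_mul hL (by linarith : x + 1 ≤ y + 1) (by linarith) (log_pos hy).le
    exact div_lt_div_of_pos_right this (by linarith)
  tendsto_ratio := by
    have h1 : ContinuousAt (fun τ : ℝ => Real.log (τ + 1) * (τ + 1) / (2 * σ - 1)) 0 := by
      have : (0 : ℝ) + 1 ≠ 0 := by norm_num
      fun_prop (disch := assumption)
    have h2 : Tendsto (fun τ : ℝ => Real.log (τ + 1) * (τ + 1) / (2 * σ - 1)) (𝓝[>] 0) (𝓝 0) := by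
      simpa using h1.tendsto.mono_left (nhdsWithin_le_nhds (s := Ioi 0))
    refine h2.congr' ?_
    filter_upwards [self_mem_nhdsWithin] with τ hτ using (ratio_h hσ hτ).symm

theorem logLaw_E {K₀ c σ : ℝ} (hK₀ : 0 < K₀) (hc : 0 < c) (hσ : 1 / 2 < σ) (hσ' : σ ≤ 1) :
    (logLaw hK₀ hc hσ hσ').E = logEnergy K₀ c σ := by
  funext τ S
  simp only [GasLaw.E, logLaw, logEnergy]
  ring

end GasRiemann

theorem mainTheorem4 (K₀ c σ : ℝ) (hK₀ : 0 < K₀) (hc : 0 < c) (hσ : 1 / 2 < σ) (hσ' : σ ≤ 1)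
    (UL UR : GasRiemann.State) (hL : 0 < UL.ρ) (hR : 0 < UR.ρ) :
    ∃ V : ℝ → GasRiemann.State,
      GasRiemann.IsRiemannSolution (GasRiemann.logEnergy K₀ c σ) UL UR V ∧
      (∃ δ : ℝ, 0 < δ ∧ ∀ ξ : ℝ, δ ≤ (V ξ).ρ) ∧
      ∀ V' : ℝ → GasRiemann.State,
        GasRiemann.IsRiemannSolution (GasRiemann.logEnergy K₀ c σ) UL UR V' →
          {ξ : ℝ | V' ξ ≠ V ξ}.Finite := by
  rw [← GasRiemann.logLaw_E hK₀ hc hσ hσ']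
  exact GasRiemann.GasLaw.riemann_problem hL hR
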